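/- A compact polyhedron is a subset of a finite-dimensional real vector space that is the underlying set of a finite geometric simplicial complex (a triangulation of it). A map between polyhedra, with compact domain, is PL if it is affine on each simplex of some triangulation of its domain. A topological (resp. PL) embedding is a continuous (resp. PL) map that is a homeomorphism (resp. PL homeomorphism) onto its image. Let $f\colon N\to M$ be a non-degenerate PL map between compact polyhedra, i.e. a PL map such that no point-inverse $f^{-1}(y)$, $y\in M$, has positive dimension, and let $k\ge 0$ be an integer. Call $f$ a topological (resp. PL) $k$-prem if there is a map $g\colon N\to\mathbb R^k$ such that $f\times g\colon N\to M\times\mathbb R^k$, $x\mapsto (f(x),g(x))$, is a topological (resp. PL) embedding. A lift of $f$ is a map $e\colon N\to M\times\mathbb R^k$ whose composition with the projection $M\times\mathbb R^k\to M$ is $f$. Then: 1. $f$ is a topological $k$-prem if and only if it is a PL $k$-prem. 2. Every topological embedding $e\colon N\to M\times\mathbb R^k$ that lifts $f$ is isotopic through lifts of $f$ to a PL embedding; that is, there is a continuous map $H\colon [0,1]\times N\to M\times\mathbb R^k$ such that every $H_t=H(t,\cdot)$ is a topological embedding which lifts $f$, $H_0=e$, and $H_1$ is a PL embedding. 3.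 If moreover $N_0\subseteq N$ is a compact subpolyhedron and $e|_{N_0}$ is PL, then the isotopy in 2 may be chosen to keep $N_0$ fixed, i.e. $H_t(x)=e(x)$ for all $t\in[0,1]$ and $x\in N_0$. -/

import Mathlib

section PLTopology

variable {E F V : Type*}
  [NormedAddCommGroup E] [NormedSpace ℝ E]
  [NormedAddCommGroup F] [NormedSpace ℝ F]
  [NormedAddCommGroup V] [NormedSpace ℝ V]

/-- `K` is a (finite, geometric) triangulation of the set `P`. -/
def IsTriangulation (K : Geometry.SimplicialComplex ℝ E) (P : Set E) : Prop :=
  K.faces.Finite ∧ K.space = P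

/-- A compact polyhedron: the underlying set of a finite geometric simplicial complex. -/
def IsCompactPolyhedron (P : Set E) : Prop :=
  ∃ K : Geometry.SimplicialComplex ℝ E, IsTriangulation K P

/-- A map `h : P → V` from a compact polyhedron to a vector space is PL if it is affine on every
simplex of some triangulation of `P`. A map into a polyhedron `Q ⊆ V` is PL if it is PL as a map
into `V`. -/
def IsPL {P : Set E} (h : P → V) : Prop :=
  ∃ K : Geometry.SimplicialComplex ℝ E, IsTriangulation K P ∧
    ∀ s ∈ K.faces, ∃ A : E →ᵃ[ℝ] V, ∀ x : P, (x : E) ∈ convexHull ℝ (s : Set E) → h x = A x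

/-- A PL embedding: a PL map which is a PL homeomorphism onto its image, i.e. its inverse
`Set.range h → P` exists and is PL as well. -/
def IsPLEmbedding {P : Set E} (h : P → V) : Prop :=
  IsPL h ∧ ∃ r : Set.range h → P,
    IsPL (fun y => (r y : E)) ∧ Function.LeftInverse r (Set.rangeFactorization h)

/-- The dimension of a polyhedron `P`: the largest dimension of a simplex contained in `P`
(`⊥` if `P` is empty). -/
noncomputable def polyhedronDim (P : Set E) : WithBot ℕ∞ :=
  sSup ((fun n : ℕ => (n : WithBot ℕ∞)) ''
    {n | ∃ v : Fin (n + 1) → E, AffineIndependent ℝ v ∧ convexHull ℝ (Set.range v) ⊆ P})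

/-- No point-inverse of `f` has positive dimension. -/
def IsNondegenerate {N : Set E} {M : Set F} (f : N → M) : Prop :=
  ∀ y : M, ¬ 0 < polyhedronDim ((fun x : N => (x : E)) '' (f ⁻¹' {y}))

/-- The inclusion of `M × ℝᵏ` in the vector space `F × ℝᵏ`. -/
def prodIncl {M : Set F} {k : ℕ} (p : M × EuclideanSpace ℝ (Fin k)) :
    F × EuclideanSpace ℝ (Fin k) :=
  (p.1, p.2)

/-- `f` is a topological `k`-prem. -/
def IsTopologicalPrem {N : Set E} {M : Set F} (k : ℕ) (f : N → M) : Prop :=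
  ∃ g : N → EuclideanSpace ℝ (Fin k), Topology.IsEmbedding (fun x => (f x, g x))

/-- `f` is a PL `k`-prem. -/
def IsPLPrem {N : Set E} {M : Set F} (k : ℕ) (f : N → M) : Prop :=
  ∃ g : N → EuclideanSpace ℝ (Fin k), IsPLEmbedding (fun x => prodIncl (f x, g x))

/-- `e : N → M × ℝᵏ` lifts `f : N → M`. -/
def IsLift {N : Set E} {M : Set F} {k : ℕ} (f : N → M)
    (e : N → M × EuclideanSpace ℝ (Fin k)) : Prop :=
  ∀ x, (e x).1 = f x

/-- `e` is isotopic to `e'` through lifts of `f`, by an isotopy keeping `N₀` fixed. -/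
def IsotopicThroughLiftsRel {N : Set E} {M : Set F} {k : ℕ} (f : N → M) (N₀ : Set E)
    (e e' : N → M × EuclideanSpace ℝ (Fin k)) : Prop :=
  ∃ H : unitInterval × N → M × EuclideanSpace ℝ (Fin k),
    Continuous H ∧
    (∀ x, H (0, x) = e x) ∧
    (∀ x, H (1, x) = e' x) ∧
    (∀ t, Topology.IsEmbedding (fun x => H (t, x)) ∧ IsLift f (fun x => H (t, x))) ∧
    (∀ t, ∀ x : N, (x : E) ∈ N₀ → H (t, x) = e x)

end PLTopology

/-!
Write `e = (f, g)`. The map `g` is replaced by a map that is affine on the simplices of a suitable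
triangulation, by a homotopy `g_t` for which every `(f, g_t)` is injective; since `N` is compact,
these are then embeddings.

Non-degeneracy makes `f` injective on the simplices of a triangulation of `N` on which it is affine.
Edge bisections subdivide the triangulations of `N` and `f(N)` so that, over every simplex of
`f(N)`, the vertices can be ordered by how many sheets of `f` pass over them: two lifts of a simplex
then meet exactly in a common initial face. Because `(f, g)` is injective, further bisections
separate disjoint lifts, that is, make their images under `g` have disjoint convex hulls.

For a point `x` with barycentric weights `w`, extract the first `t` units of mass in this order.
Then `g_t(x)` sends the extracted mass to its mean under the linear extension of `g`, and the
remaining mass to `1 - t` times the value of `g` at the normalized remainder. So `g_0 = g`, while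
`g_1` is affine on simplices. Suppose that `x` and `y` lie over the same point, with
`g_t(x) = g_t(y)`. Either the mass at the common vertices is not exhausted at time `t`; then the
extracted parts agree, and the injectivity of `(f, g)` applies to the remainders. Or it is
exhausted; then what is left of `x` and `y` has values in the disjoint convex hulls.

Points of a face on which `g` is already affine do not move, so the relative version follows by
first making `N₀` a union of faces.
-/

namespace PLLift

open scoped Classical
open Set

section Weights

variable {ι κ V : Type*} [AddCommGroup V] [Module ℝ V]

/-- The linear combination of the values of `h` with coefficients `w`. -/
noncomputable abbrev lc (h : ι → V) : (ι →₀ ℝ) →ₗ[ℝ] V := Finsupp.linearCombination ℝ h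

/-- Barycentric weights: finitely supported nonnegative coefficients of total mass one. -/
structure IsWeight (w : ι →₀ ℝ) : Prop where
  nonneg : ∀ v, 0 ≤ w v
  mass : lc (fun _ => (1 : ℝ)) w = 1

theorem lc_eq_sum {w : ι →₀ ℝ} {s : Finset ι} (hs : w.support ⊆ s) (h : ι → V) :
    lc h w = ∑ v ∈ s, w v • h v := by
  rw [Finsupp.linearCombination_apply, Finsupp.sum_of_support_subset _ hs _ (by simp)]

theorem lc_congr {w : ι →₀ ℝ} {h h' : ι → V} (hh : ∀ v ∈ w.support, h v = h' v) :
    lc h w = lc h' w :=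
  Finset.sum_congr rfl fun v hv => by simp [hh v hv]

theorem lc_mapDomain (f : ι → κ) (h : κ → V) (w : ι →₀ ℝ) :
    lc h (w.mapDomain f) = lc (h ∘ f) w :=
  Finsupp.linearCombination_mapDomain ℝ f w

theorem lc_one_eq_sum {w : ι →₀ ℝ} {s : Finset ι} (hs : w.support ⊆ s) :
    lc (fun _ => (1 : ℝ)) w = ∑ v ∈ s, w v := by
  simp [lc_eq_sum hs]

theorem affineMap_lc {E : Type*} [AddCommGroup E] [Module ℝ E] (A : E →ᵃ[ℝ] V) (p : ι → E)
    {w : ι →₀ ℝ} (hw : lc (fun _ => (1 : ℝ)) w = 1) : A (lc p w) = lc (A ∘ p) w := by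
  have hsum : ∑ v ∈ w.support, w v = 1 := by rw [← lc_one_eq_sum subset_rfl, hw]
  rw [lc_eq_sum subset_rfl, lc_eq_sum subset_rfl,
    ← Finset.affineCombination_eq_linear_combination _ _ _ hsum,
    Finset.map_affineCombination _ _ _ hsum,
    Finset.affineCombination_eq_linear_combination _ _ _ hsum]

theorem isWeight_single (v : ι) : IsWeight (Finsupp.single v (1 : ℝ)) :=
  ⟨Finsupp.single_nonneg.2 zero_le_one, by simp⟩

namespace IsWeight

variable {w : ι →₀ ℝ}

theorem support_nonempty (hw : IsWeight w) : w.support.Nonempty := by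
  rw [Finsupp.support_nonempty_iff]
  rintro rfl
  simpa using hw.mass

theorem pos (hw : IsWeight w) {v : ι} (hv : v ∈ w.support) : 0 < w v :=
  (hw.nonneg v).lt_of_ne' (Finsupp.mem_support_iff.1 hv)

theorem sum_eq_one (hw : IsWeight w) {s : Finset ι} (hs : w.support ⊆ s) : ∑ v ∈ s, w v = 1 :=
  (lc_one_eq_sum hs).symm.trans hw.mass

theorem sum_sdiff_eq_sum_sdiff {w' : ι →₀ ℝ} (hw : IsWeight w) (hw' : IsWeight w')
    (h : ∀ v ∈ w.support ∩ w'.support, w v = w' v) :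
    ∑ v ∈ w.support \ w'.support, w v = ∑ v ∈ w'.support \ w.support, w' v := by
  have hone := hw.sum_eq_one subset_rfl
  have hone' := hw'.sum_eq_one subset_rfl
  rw [← Finset.sum_inter_add_sum_sdiff _ w'.support, Finset.sum_congr rfl h] at hone
  rw [← Finset.sum_inter_add_sum_sdiff _ w.support, Finset.inter_comm] at hone'
  linarith

theorem lc_mem (hw : IsWeight w) {h : ι → V} {C : Set V} (hC : Convex ℝ C)
    (hh : ∀ v ∈ w.support, h v ∈ C) : lc h w ∈ C :=
  hC.sum_mem (fun v _ => hw.nonneg v) (hw.sum_eq_one subset_rfl) hh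

theorem lc_id_mem {w : V →₀ ℝ} (hw : IsWeight w) {C : Set V} (hC : Convex ℝ C)
    (hh : (w.support : Set V) ⊆ C) : lc id w ∈ C :=
  hw.lc_mem hC hh

theorem mapDomain (hw : IsWeight w) (f : ι → κ) : IsWeight (w.mapDomain f) :=
  ⟨fun v => Finsupp.mapDomain_nonneg (f := f) hw.nonneg v, (lc_mapDomain f _ w).trans hw.mass⟩

theorem support_mapDomain (hw : IsWeight w) (f : ι → κ) :
    (w.mapDomain f).support = w.support.image f := by
  refine subset_antisymm Finsupp.mapDomain_support (Finset.image_subset_iff.2 fun u hu => ?_)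
  rw [Finsupp.mem_support_iff, Finsupp.mapDomain, Finsupp.sum, Finsupp.finsetSum_apply]
  exact (Finset.sum_pos' (fun v _ => Finsupp.single_nonneg.2 (hw.nonneg v) _)
    ⟨u, hu, by simpa using hw.pos hu⟩).ne'

theorem exists_mapDomain_eq {w : κ →₀ ℝ} (hw : IsWeight w) {f : ι → κ} {s : Finset ι}
    (hs : w.support ⊆ s.image f) : ∃ u, IsWeight u ∧ u.support ⊆ s ∧ u.mapDomain f = w := by
  have hex : ∀ v ∈ w.support, ∃ a ∈ (s : Set ι), f a = v := fun v hv => by simpa using hs hv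
  have := (hex _ hw.support_nonempty.choose_spec).nonempty
  refine ⟨w.mapDomain (Function.invFunOn f s), hw.mapDomain _, ?_, ?_⟩
  · rw [hw.support_mapDomain]
    exact Finset.image_subset_iff.2 fun v hv => Function.invFunOn_mem (hex v hv)
  · rw [← Finsupp.mapDomain_comp]
    exact (Finsupp.mapDomain_congr fun v hv => Function.invFunOn_eq (hex v hv)).trans
      Finsupp.mapDomain_id

end IsWeight

theorem mem_convexHull_iff_weight {s : Finset V} {x : V} :
    x ∈ convexHull ℝ (s : Set V) ↔ ∃ w : V →₀ ℝ, IsWeight w ∧ w.support ⊆ s ∧ lc id w = x := by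
  constructor
  · rw [Finset.mem_convexHull']
    rintro ⟨c, h0, h1, rfl⟩
    have hsupp := Finsupp.support_indicator_subset s fun v _ => c v
    refine ⟨_, ⟨fun v => ?_, ?_⟩, hsupp, ?_⟩
    · rw [Finsupp.indicator_apply]
      split_ifs with h
      exacts [h0 v h, le_rfl]
    · rw [lc_one_eq_sum hsupp, ← h1]
      exact Finset.sum_congr rfl fun v hv => Finsupp.indicator_of_mem hv _
    · rw [lc_eq_sum hsupp]
      exact Finset.sum_congr rfl fun v hv => by rw [Finsupp.indicator_of_mem hv, id]
  · rintro ⟨w, hw, hs, rfl⟩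
    exact hw.lc_id_mem (convex_convexHull ℝ _) fun v hv => subset_convexHull ℝ _ (hs hv)

theorem eq_of_affineIndependent {s : Finset V} (hs : AffineIndependent ℝ ((↑) : s → V))
    {w w' : V →₀ ℝ} (hw : IsWeight w) (hw' : IsWeight w') (h : w.support ⊆ s)
    (h' : w'.support ⊆ s) (he : lc id w = lc id w') : w = w' := by
  have hmass := hw.mass.trans hw'.mass.symm
  rw [lc_one_eq_sum h, lc_one_eq_sum h', ← sub_eq_zero, ← Finset.sum_sub_distrib,
    ← Finset.sum_coe_sort s] at hmass
  rw [lc_eq_sum h, lc_eq_sum h', ← sub_eq_zero, ← Finset.sum_sub_distrib,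
    ← Finset.sum_coe_sort s] at he
  simp only [id, ← sub_smul] at he
  have hzero := affineIndependent_iff.1 hs Finset.univ _ hmass he
  ext v
  by_cases hv : v ∈ s
  · exact sub_eq_zero.1 (hzero ⟨v, hv⟩ (Finset.mem_univ _))
  · rw [Finsupp.notMem_support_iff.1 fun hh => hv (h hh),
      Finsupp.notMem_support_iff.1 fun hh => hv (h' hh)]

end Weights

section Complexes

variable {E : Type*} [AddCommGroup E] [Module ℝ E]

/-- A finite simplicial complex, given by its set of faces (including the empty one): the faces
form a lower set, and every point has at most one system of barycentric weights carried by a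
face. -/
structure IsComplex (S : Finset (Finset E)) : Prop where
  down : ∀ s ∈ S, ∀ t ⊆ s, t ∈ S
  uniq : ∀ w w' : E →₀ ℝ, IsWeight w → IsWeight w' → w.support ∈ S → w'.support ∈ S →
    lc id w = lc id w' → w = w'

/-- The underlying set of a complex: all weighted means of the vertices of a face. -/
def space (S : Finset (Finset E)) : Set E :=
  {x | ∃ w : E →₀ ℝ, IsWeight w ∧ w.support ∈ S ∧ lc id w = x}

theorem space_powerset (s : Finset E) : space s.powerset = convexHull ℝ (s : Set E) := by
  ext x
  rw [mem_convexHull_iff_weight]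
  simp only [space, Finset.mem_powerset, mem_ofPred_eq]

namespace IsComplex

variable {S : Finset (Finset E)} {s t : Finset E} {x : E}

theorem mem_space_iff (hS : IsComplex S) :
    x ∈ space S ↔ ∃ s ∈ S, x ∈ convexHull ℝ (s : Set E) := by
  constructor
  · rintro ⟨w, hw, hs, rfl⟩
    exact ⟨_, hs, mem_convexHull_iff_weight.2 ⟨w, hw, subset_rfl, rfl⟩⟩
  · rintro ⟨s, hs, hx⟩
    obtain ⟨w, hw, hws, rfl⟩ := mem_convexHull_iff_weight.1 hx
    exact ⟨w, hw, hS.down s hs _ hws, rfl⟩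

theorem mem_space (hS : IsComplex S) (hs : s ∈ S) (hx : x ∈ s) : x ∈ space S :=
  hS.mem_space_iff.2 ⟨s, hs, subset_convexHull ℝ _ hx⟩

theorem support_subset (hS : IsComplex S) {w : E →₀ ℝ} (hw : IsWeight w) (hwS : w.support ∈ S)
    (hs : s ∈ S) (hx : lc id w ∈ convexHull ℝ (s : Set E)) : w.support ⊆ s := by
  obtain ⟨w', hw', hws, he⟩ := mem_convexHull_iff_weight.1 hx
  rw [hS.uniq w w' hw hw' hwS (hS.down s hs _ hws) he.symm]
  exact hws

theorem convexHull_inter (hS : IsComplex S) (hs : s ∈ S) (ht : t ∈ S)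
    (hxs : x ∈ convexHull ℝ (s : Set E)) (hxt : x ∈ convexHull ℝ (t : Set E)) :
    x ∈ convexHull ℝ ((s ∩ t : Finset E) : Set E) := by
  obtain ⟨w, hw, hws, rfl⟩ := mem_convexHull_iff_weight.1 hxs
  exact mem_convexHull_iff_weight.2 ⟨w, hw, Finset.subset_inter hws
    (hS.support_subset hw (hS.down s hs _ hws) ht hxt), rfl⟩

theorem affineIndependent (hS : IsComplex S) (hs : s ∈ S) :
    AffineIndependent ℝ ((↑) : s → E) := by
  by_contra hdep
  obtain ⟨I, x, hx, hx'⟩ := Convex.radon_partition hdep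
  have mem_hull (J : Set s) (hJ : x ∈ convexHull ℝ ((↑) '' J)) :
      x ∈ convexHull ℝ ((J.toFinset.image (↑) : Finset E) : Set E) := by simpa using hJ
  have sub_mem (J : Set s) : J.toFinset.image (↑) ∈ S :=
    hS.down s hs _ (Finset.image_subset_iff.2 fun v _ => v.2)
  have := hS.convexHull_inter (sub_mem I) (sub_mem Iᶜ) (mem_hull I hx) (mem_hull Iᶜ hx')
  rw [← Finset.image_inter _ _ Subtype.val_injective] at this
  simp at this

/-- The geometric simplicial complex with the nonempty faces of a complex. -/
def toSimplicialComplex (hS : IsComplex S) : Geometry.SimplicialComplex ℝ E :=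
  Geometry.SimplicialComplex.ofErase (S : Set (Finset E)) (fun _ hs => hS.affineIndependent hs)
    (fun s t hts hs => hS.down s hs t hts)
    (fun s hs t ht x hx => by simpa using hS.convexHull_inter hs ht hx.1 hx.2)

theorem isTriangulation {E : Type*} [NormedAddCommGroup E] [NormedSpace ℝ E]
    {S : Finset (Finset E)} (hS : IsComplex S) :
    IsTriangulation hS.toSimplicialComplex (space S) := by
  refine ⟨S.finite_toSet.subset fun s hs => hs.1, Set.ext fun x => ?_⟩
  rw [hS.mem_space_iff, Geometry.SimplicialComplex.mem_space_iff]
  constructor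
  · rintro ⟨s, hs, hx⟩
    exact ⟨s, hs.1, hx⟩
  · rintro ⟨s, hs, hx⟩
    refine ⟨s, ⟨hs, ?_⟩, hx⟩
    rintro rfl
    simp at hx

end IsComplex

theorem isComplex_powerset {s : Finset E} (hs : AffineIndependent ℝ ((↑) : s → E)) :
    IsComplex s.powerset where
  down _ ht _ hut := Finset.mem_powerset.2 (hut.trans (Finset.mem_powerset.1 ht))
  uniq _ _ hw hw' hws hws' he :=
    eq_of_affineIndependent hs hw hw' (Finset.mem_powerset.1 hws) (Finset.mem_powerset.1 hws') he

theorem isComplex_insert_empty (K : Geometry.SimplicialComplex ℝ E) (hK : K.faces.Finite) :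
    IsComplex (insert ∅ hK.toFinset) where
  down s hs t hts := by
    simp only [Finset.mem_insert, Finite.mem_toFinset] at hs ⊢
    rcases t.eq_empty_or_nonempty with rfl | ht
    · exact Or.inl rfl
    · exact Or.inr (K.down_closed (hs.resolve_left (ht.mono hts).ne_empty) hts ht)
  uniq w w' hw hw' hs hs' he := by
    simp only [Finset.mem_insert, Finite.mem_toFinset] at hs hs'
    have hsK := hs.resolve_left hw.support_nonempty.ne_empty
    have hsK' := hs'.resolve_left hw'.support_nonempty.ne_empty
    have hx : lc id w ∈ convexHull ℝ ((w.support ∩ w'.support : Finset E) : Set E) := by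
      rw [Finset.coe_inter]
      exact K.inter_subset_convexHull hsK hsK'
        ⟨mem_convexHull_iff_weight.2 ⟨w, hw, subset_rfl, rfl⟩,
          mem_convexHull_iff_weight.2 ⟨w', hw', subset_rfl, he.symm⟩⟩
    obtain ⟨u, hu, hus, hux⟩ := mem_convexHull_iff_weight.1 hx
    rw [← eq_of_affineIndependent (K.indep hsK) hu hw (hus.trans Finset.inter_subset_left)
      subset_rfl hux]
    exact eq_of_affineIndependent (K.indep hsK') hu hw' (hus.trans Finset.inter_subset_right)
      subset_rfl (hux.trans he)

theorem exists_isComplex (K : Geometry.SimplicialComplex ℝ E) (hK : K.faces.Finite) :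
    ∃ S : Finset (Finset E), IsComplex S ∧ (∀ s, s ∈ S ↔ s = ∅ ∨ s ∈ K.faces) ∧
      space S = K.space := by
  have hS := isComplex_insert_empty K hK
  refine ⟨_, hS, by simp, Set.ext fun x => ?_⟩
  rw [hS.mem_space_iff, K.mem_space_iff]
  constructor
  · rintro ⟨s, hs, hx⟩
    obtain rfl | hs : s = ∅ ∨ s ∈ K.faces := by simpa using hs
    · simp at hx
    · exact ⟨s, hs, hx⟩
  · rintro ⟨s, hs, hx⟩
    exact ⟨s, by simp [hs], hx⟩

end Complexes

section Bisection

variable {ι : Type*} {a b m : ι} {r c : ℝ} {w w' : ι →₀ ℝ}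

/-- Moves the mass `c` from `m` to `a` and `b`, in the ratio `1 - r : r`. For `m` on the edge from
`a` to `b`, this relates weights on a complex to weights on its subdivision at `m`. -/
noncomputable def spread (a b m : ι) (r c : ℝ) (w : ι →₀ ℝ) : ι →₀ ℝ :=
  w + c • (Finsupp.single a (1 - r) + Finsupp.single b r - Finsupp.single m 1)

theorem spread_zero : spread a b m r 0 w = w := by
  simp [spread]

theorem spread_apply_left (hab : a ≠ b) (hma : m ≠ a) :
    spread a b m r c w a = w a + c * (1 - r) := by
  simp [spread, hab, hma.symm]

theorem spread_apply_right (hab : a ≠ b) (hmb : m ≠ b) :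
    spread a b m r c w b = w b + c * r := by
  simp [spread, hab.symm, hmb.symm]

theorem spread_apply_mid (hma : m ≠ a) (hmb : m ≠ b) : spread a b m r c w m = w m - c := by
  simp [spread, hma, hmb, sub_eq_add_neg]

theorem spread_apply_of_ne {v : ι} (hva : v ≠ a) (hvb : v ≠ b) (hvm : v ≠ m) :
    spread a b m r c w v = w v := by
  simp [spread, hva, hvb, hvm]

theorem lc_spread {V : Type*} [AddCommGroup V] [Module ℝ V] (h : ι → V)
    (hm : h m = (1 - r) • h a + r • h b) : lc h (spread a b m r c w) = lc h w := by
  simp only [spread, map_add, map_sub, map_smul, Finsupp.linearCombination_single, hm]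
  module

theorem support_spread_erase_subset :
    (spread a b m r c w).support.erase m ⊆ {a, b} ∪ w.support.erase m := by
  intro v hv
  obtain ⟨hvm, hv⟩ := Finset.mem_erase.1 hv
  by_cases hva : v = a
  · simp [hva]
  by_cases hvb : v = b
  · simp [hvb]
  rw [Finsupp.mem_support_iff, spread_apply_of_ne hva hvb hvm] at hv
  simp [hva, hvb, hvm, hv]

theorem IsWeight.spread (hw : IsWeight w) (hab : a ≠ b) (hma : m ≠ a) (hmb : m ≠ b)
    (hm : c ≤ w m) (ha : 0 ≤ w a + c * (1 - r)) (hb : 0 ≤ w b + c * r) :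
    IsWeight (spread a b m r c w) := by
  refine ⟨fun v => ?_, (lc_spread _ (by simp)).trans hw.mass⟩
  by_cases hva : v = a
  · rwa [hva, spread_apply_left hab hma]
  by_cases hvb : v = b
  · rwa [hvb, spread_apply_right hab hmb]
  by_cases hvm : v = m
  · rw [hvm, spread_apply_mid hma hmb]
    exact sub_nonneg.2 hm
  · rw [spread_apply_of_ne hva hvb hvm]
    exact hw.nonneg v

theorem IsWeight.spread_all (hw : IsWeight w) (hab : a ≠ b) (hma : m ≠ a) (hmb : m ≠ b)
    (hr0 : 0 < r) (hr1 : r < 1) : IsWeight (PLLift.spread a b m r (w m) w) :=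
  hw.spread hab hma hmb le_rfl
    (add_nonneg (hw.nonneg a) (mul_nonneg (hw.nonneg m) (sub_nonneg.2 hr1.le)))
    (add_nonneg (hw.nonneg b) (mul_nonneg (hw.nonneg m) hr0.le))

theorem le_of_spread_eq (hw : IsWeight w) (hab : a ≠ b) (hma : m ≠ a) (hmb : m ≠ b)
    (hr0 : 0 < r) (hr1 : r < 1) (hw'ab : ¬ {a, b} ⊆ w'.support)
    (he : spread a b m r (w m) w = spread a b m r (w' m) w') : w m ≤ w' m := by
  by_contra! hlt
  have ha := DFunLike.congr_fun he a
  have hb := DFunLike.congr_fun he b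
  rw [spread_apply_left hab hma, spread_apply_left hab hma] at ha
  rw [spread_apply_right hab hmb, spread_apply_right hab hmb] at hb
  refine hw'ab (Finset.insert_subset (Finsupp.mem_support_iff.2 ?_)
    (Finset.singleton_subset_iff.2 (Finsupp.mem_support_iff.2 ?_)))
  · nlinarith [hw.nonneg a]
  · nlinarith [hw.nonneg b]

theorem eq_of_spread_eq (hw : IsWeight w) (hw' : IsWeight w') (hab : a ≠ b) (hma : m ≠ a)
    (hmb : m ≠ b) (hr0 : 0 < r) (hr1 : r < 1) (hwab : ¬ {a, b} ⊆ w.support)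
    (hw'ab : ¬ {a, b} ⊆ w'.support)
    (he : spread a b m r (w m) w = spread a b m r (w' m) w') : w = w' := by
  have hmm : w m = w' m := le_antisymm (le_of_spread_eq hw hab hma hmb hr0 hr1 hw'ab he)
    (le_of_spread_eq hw' hab hma hmb hr0 hr1 hwab he.symm)
  rw [hmm] at he
  exact add_right_cancel he

theorem IsWeight.exists_spread_neg (hw : IsWeight w) (hab : a ≠ b) (hma : m ≠ a) (hmb : m ≠ b)
    (hr0 : 0 < r) (hr1 : r < 1) (ha : a ∈ w.support) (hb : b ∈ w.support) :
    ∃ c < 0, IsWeight (PLLift.spread a b m r c w) ∧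
      ¬ {a, b} ⊆ (PLLift.spread a b m r c w).support := by
  have hr1' : 0 < 1 - r := sub_pos.2 hr1
  set c := min (w a / (1 - r)) (w b / r) with hc
  have hc0 : 0 < c := lt_min (div_pos (hw.pos ha) hr1') (div_pos (hw.pos hb) hr0)
  have hca : c * (1 - r) ≤ w a := (le_div_iff₀ hr1').1 (min_le_left _ _)
  have hcb : c * r ≤ w b := (le_div_iff₀ hr0).1 (min_le_right _ _)
  refine ⟨-c, neg_lt_zero.2 hc0, hw.spread hab hma hmb ?_ (by linarith) (by linarith), ?_⟩
  · linarith [hw.nonneg m]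
  · rw [Finset.insert_subset_iff, Finset.singleton_subset_iff, Finsupp.mem_support_iff,
      Finsupp.mem_support_iff, spread_apply_left hab hma, spread_apply_right hab hmb]
    rintro ⟨hna, hnb⟩
    rcases min_choice (w a / (1 - r)) (w b / r) with h | h
    · refine hna ?_
      rw [hc, h]
      field_simp
      ring
    · refine hnb ?_
      rw [hc, h]
      field_simp
      ring

/-- The subdivision of `S` by the new vertex `m` on the edge from `a` to `b`. -/
noncomputable def bisect (S : Finset (Finset ι)) (a b m : ι) : Finset (Finset ι) :=
  S.filter (fun s => ¬ {a, b} ⊆ s) ∪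
    (S.filter (fun t => ¬ {a, b} ⊆ t ∧ {a, b} ∪ t ∈ S)).image (insert m)

theorem mem_bisect {S : Finset (Finset ι)} {s : Finset ι} :
    s ∈ bisect S a b m ↔ (s ∈ S ∧ ¬ {a, b} ⊆ s) ∨
      ∃ t ∈ S, ¬ {a, b} ⊆ t ∧ {a, b} ∪ t ∈ S ∧ insert m t = s := by
  simp only [bisect, Finset.mem_union, Finset.mem_filter, Finset.mem_image, and_assoc]

theorem not_subset_of_mem_bisect {S : Finset (Finset ι)} (hma : m ≠ a) (hmb : m ≠ b)
    {s : Finset ι} (hs : s ∈ bisect S a b m) : ¬ {a, b} ⊆ s := by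
  rcases mem_bisect.1 hs with h | ⟨t, -, ht, -, rfl⟩
  · exact h.2
  · rwa [Finset.subset_insert_iff_of_notMem (by simp [hma, hmb])]

theorem mem_bisect_of_subset {S : Finset (Finset ι)} (hS : ∀ s ∈ S, ∀ t ⊆ s, t ∈ S)
    {s t : Finset ι} (hs : s ∈ bisect S a b m) (hts : t ⊆ s) : t ∈ bisect S a b m := by
  rcases mem_bisect.1 hs with ⟨hsS, hsab⟩ | ⟨u, huS, huab, huS', rfl⟩
  · exact mem_bisect.2 (Or.inl ⟨hS s hsS t hts, fun h => hsab (h.trans hts)⟩)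
  by_cases hmt : m ∈ t
  · have hu : t.erase m ⊆ u := Finset.subset_insert_iff.1 hts
    exact mem_bisect.2 (Or.inr ⟨t.erase m, hS u huS _ hu, fun h => huab (h.trans hu),
      hS _ huS' _ (Finset.union_subset_union_right hu), Finset.insert_erase hmt⟩)
  · have hu : t ⊆ u := (Finset.subset_insert_iff_of_notMem hmt).1 hts
    exact mem_bisect.2 (Or.inl ⟨hS u huS t hu, fun h => huab (h.trans hu)⟩)

theorem support_spread_all_mem {S : Finset (Finset ι)} (hS : ∀ s ∈ S, ∀ t ⊆ s, t ∈ S)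
    (hma : m ≠ a) (hmb : m ≠ b) (hmS : ∀ s ∈ S, m ∉ s) (hws : w.support ∈ bisect S a b m) :
    (spread a b m r (w m) w).support ∈ S := by
  rcases mem_bisect.1 hws with ⟨hwS, -⟩ | ⟨t, -, -, htS, ht⟩
  · rwa [Finsupp.notMem_support_iff.1 (hmS _ hwS), spread_zero]
  · have hm : m ∉ (spread a b m r (w m) w).support := by simp [spread_apply_mid hma hmb]
    rw [← Finset.erase_eq_of_notMem hm]
    refine hS _ htS _ (support_spread_erase_subset.trans (Finset.union_subset_union_right ?_))
    rw [← ht]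
    exact Finset.erase_insert_subset m t

theorem support_spread_neg_mem {S : Finset (Finset ι)} (hS : ∀ s ∈ S, ∀ t ⊆ s, t ∈ S)
    (hma : m ≠ a) (hmb : m ≠ b) (hw : IsWeight w) (hws : w.support ∈ S)
    (hab : {a, b} ⊆ w.support) (hc : c < 0) (hwab : ¬ {a, b} ⊆ (spread a b m r c w).support) :
    (spread a b m r c w).support ∈ bisect S a b m := by
  set u := (spread a b m r c w).support with hu
  have hm : m ∈ u := by
    rw [hu, Finsupp.mem_support_iff, spread_apply_mid hma hmb]
    linarith [hw.nonneg m]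
  have huw : u.erase m ⊆ w.support :=
    support_spread_erase_subset.trans (Finset.union_subset hab (Finset.erase_subset _ _))
  exact mem_bisect.2 (Or.inr ⟨u.erase m, hS _ hws _ huw,
    fun h => hwab (h.trans (Finset.erase_subset _ _)), hS _ hws _ (Finset.union_subset hab huw),
    Finset.insert_erase hm⟩)

variable {E : Type*} [AddCommGroup E] [Module ℝ E]

theorem ne_left_of_mem_openSegment {a b m : E} (hab : a ≠ b) (hm : m ∈ openSegment ℝ a b) :
    m ≠ a := by
  rintro rfl
  exact hab (left_mem_openSegment_iff.1 hm)

theorem ne_right_of_mem_openSegment {a b m : E} (hab : a ≠ b) (hm : m ∈ openSegment ℝ a b) :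
    m ≠ b := by
  rintro rfl
  exact hab (right_mem_openSegment_iff.1 hm)

theorem exists_eq_of_mem_openSegment {a b m : E} (hm : m ∈ openSegment ℝ a b) :
    ∃ r : ℝ, 0 < r ∧ r < 1 ∧ m = (1 - r) • a + r • b := by
  obtain ⟨p, q, hp, hq, hpq, rfl⟩ := hm
  exact ⟨q, hq, by linarith, by rw [← hpq, add_sub_cancel_right]⟩

namespace IsComplex

variable {S : Finset (Finset E)} {a b m : E}

theorem notMem_of_mem_openSegment (hS : IsComplex S) (hab : a ≠ b) (habS : {a, b} ∈ S)
    (hm : m ∈ openSegment ℝ a b) {s : Finset E} (hs : s ∈ S) : m ∉ s := by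
  intro hms
  have hsupp : (Finsupp.single m (1 : ℝ)).support = {m} :=
    Finsupp.support_single m one_ne_zero
  have hmab : (Finsupp.single m (1 : ℝ)).support ⊆ {a, b} := by
    refine hS.support_subset (isWeight_single m) ?_ habS ?_
    · rw [hsupp]
      exact hS.down s hs _ (Finset.singleton_subset_iff.2 hms)
    · simpa [convexHull_pair] using openSegment_subset_segment ℝ a b hm
  rw [hsupp] at hmab
  simp [ne_left_of_mem_openSegment hab hm, ne_right_of_mem_openSegment hab hm] at hmab

theorem bisect (hS : IsComplex S) (hab : a ≠ b) (habS : {a, b} ∈ S)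
    (hm : m ∈ openSegment ℝ a b) : IsComplex (bisect S a b m) where
  down _ hs _ hts := mem_bisect_of_subset hS.down hs hts
  uniq w w' hw hw' hs hs' he := by
    have hma := ne_left_of_mem_openSegment hab hm
    have hmb := ne_right_of_mem_openSegment hab hm
    have hmS := fun s hs => hS.notMem_of_mem_openSegment hab habS hm (s := s) hs
    obtain ⟨r, hr0, hr1, hmr⟩ := exists_eq_of_mem_openSegment hm
    refine eq_of_spread_eq hw hw' hab hma hmb hr0 hr1 (not_subset_of_mem_bisect hma hmb hs)
      (not_subset_of_mem_bisect hma hmb hs') (hS.uniq _ _ (hw.spread_all hab hma hmb hr0 hr1)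
        (hw'.spread_all hab hma hmb hr0 hr1) (support_spread_all_mem hS.down hma hmb hmS hs)
        (support_spread_all_mem hS.down hma hmb hmS hs') ?_)
    rw [lc_spread id hmr, lc_spread id hmr, he]

theorem space_bisect (hS : IsComplex S) (hab : a ≠ b) (habS : {a, b} ∈ S)
    (hm : m ∈ openSegment ℝ a b) : space (PLLift.bisect S a b m) = space S := by
  have hma := ne_left_of_mem_openSegment hab hm
  have hmb := ne_right_of_mem_openSegment hab hm
  have hmS := fun s hs => hS.notMem_of_mem_openSegment hab habS hm (s := s) hs
  obtain ⟨r, hr0, hr1, hmr⟩ := exists_eq_of_mem_openSegment hm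
  ext x
  constructor
  · rintro ⟨w, hw, hs, rfl⟩
    exact ⟨_, hw.spread_all hab hma hmb hr0 hr1, support_spread_all_mem hS.down hma hmb hmS hs,
      lc_spread id hmr⟩
  · rintro ⟨w, hw, hs, rfl⟩
    by_cases hwab : {a, b} ⊆ w.support
    · obtain ⟨c, hc, hwc, hcab⟩ := hw.exists_spread_neg hab hma hmb hr0 hr1
        (hwab (by simp)) (hwab (by simp))
      exact ⟨_, hwc, support_spread_neg_mem hS.down hma hmb hw hs hwab hc hcab, lc_spread id hmr⟩
    · exact ⟨w, hw, mem_bisect.2 (Or.inl ⟨hs, hwab⟩), rfl⟩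

end IsComplex

/-- `S'` subdivides `S`, and for all `n' ≥ n` the faces of `S'` with vertices of rank at most `n'`
lie in such faces of `S`: no vertex of rank above `n` is needed to cut a face of lower rank. -/
structure Refines (r : E → ℕ) (n : ℕ) (S' S : Finset (Finset E)) : Prop where
  space_eq : space S' = space S
  exists_face : ∀ n', n ≤ n' → ∀ s' ∈ S', (∀ v ∈ s', r v ≤ n') →
    ∃ s ∈ S, (∀ v ∈ s, r v ≤ n') ∧ convexHull ℝ (s' : Set E) ⊆ convexHull ℝ (s : Set E)

namespace Refines

variable {r : E → ℕ} {n : ℕ} {S S' S'' : Finset (Finset E)}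

theorem refl (r : E → ℕ) (n : ℕ) (S : Finset (Finset E)) : Refines r n S S :=
  ⟨rfl, fun _ _ s hs hr => ⟨s, hs, hr, subset_rfl⟩⟩

theorem trans (h : Refines r n S'' S') (h' : Refines r n S' S) : Refines r n S'' S := by
  refine ⟨h.space_eq.trans h'.space_eq, fun n' hn s hs hr => ?_⟩
  obtain ⟨s', hs', hr', hc⟩ := h.exists_face n' hn s hs hr
  obtain ⟨t, ht, hrt, hc'⟩ := h'.exists_face n' hn s' hs' hr'
  exact ⟨t, ht, hrt, hc.trans hc'⟩

theorem exists_convexHull_subset (h : Refines r n S' S) {s' : Finset E} (hs' : s' ∈ S') :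
    ∃ s ∈ S, convexHull ℝ (s' : Set E) ⊆ convexHull ℝ (s : Set E) := by
  obtain ⟨s, hs, -, hc⟩ := h.exists_face (max n (s'.sup r)) (le_max_left _ _) s' hs'
    fun v hv => (Finset.le_sup hv).trans (le_max_right _ _)
  exact ⟨s, hs, hc⟩

end Refines

theorem refines_bisect {r : E → ℕ} {n : ℕ} {S : Finset (Finset E)} (hS : IsComplex S) {a b m : E}
    (hab : a ≠ b) (habS : {a, b} ∈ S) (hm : m ∈ openSegment ℝ a b) (ha : r a ≤ n)
    (hb : r b ≤ n) : Refines r n (bisect S a b m) S := by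
  refine ⟨hS.space_bisect hab habS hm, fun n' hn s hs hr => ?_⟩
  rcases mem_bisect.1 hs with h | ⟨t, -, -, htab, rfl⟩
  · exact ⟨s, h.1, hr, subset_rfl⟩
  · have hmem : m ∈ convexHull ℝ (({a, b} ∪ t : Finset E) : Set E) :=
      segment_subset_convexHull (by simp) (by simp) (openSegment_subset_segment ℝ a b hm)
    refine ⟨_, htab, ?_, convexHull_min ?_ (convex_convexHull ℝ _)⟩
    · simp only [Finset.mem_union, Finset.mem_insert, Finset.mem_singleton]
      rintro v ((rfl | rfl) | hv)
      exacts [ha.trans hn, hb.trans hn, hr v (Finset.mem_insert_of_mem hv)]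
    · rw [Finset.coe_insert, insert_subset_iff]
      exact ⟨hmem, fun v hv => subset_convexHull ℝ _ (by simp [Finset.mem_coe.1 hv])⟩

/-- A rule for bisecting edges: which pairs of points of rank at most `n` are bad as the ends of an
edge, and where to cut such an edge. Bad edges at the new vertex have a lower level, so that
bisecting bad edges as long as there are any terminates. -/
structure BisectionRule (r : E → ℕ) (n : ℕ) where
  Bad : E → E → Prop
  level : E → E → ℕ
  mid : E → E → E
  symm : ∀ a b, Bad a b → Bad b a
  level_comm : ∀ a b, level a b = level b a
  rank_le : ∀ a b, Bad a b → r a ≤ n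
  ne : ∀ a b, Bad a b → a ≠ b
  mid_mem : ∀ a b, Bad a b → mid a b ∈ openSegment ℝ a b
  level_mid_lt : ∀ a b c, Bad a b → Bad (mid a b) c → level (mid a b) c < level a b

namespace BisectionRule

variable {r : E → ℕ} {n : ℕ} (R : BisectionRule r n) {S : Finset (Finset E)} {a b u v : E} {j : ℕ}

/-- The bad edges of `S` of level `j`. -/
noncomputable def badEdges (S : Finset (Finset E)) (j : ℕ) : Finset (E × E) :=
  (S.biUnion id ×ˢ S.biUnion id).filter fun p =>
    (∃ s ∈ S, p.1 ∈ s ∧ p.2 ∈ s) ∧ R.Bad p.1 p.2 ∧ R.level p.1 p.2 = j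

theorem mem_badEdges :
    (a, b) ∈ R.badEdges S j ↔ (∃ s ∈ S, a ∈ s ∧ b ∈ s) ∧ R.Bad a b ∧ R.level a b = j := by
  simp only [badEdges, Finset.mem_filter, Finset.mem_product, Finset.mem_biUnion, id,
    and_iff_right_iff_imp]
  rintro ⟨⟨s, hs, ha, hb⟩, -⟩
  exact ⟨⟨s, hs, ha⟩, s, hs, hb⟩

theorem level_lt_or_edge_of_bisect (hab : R.Bad a b) {s : Finset E}
    (hs : s ∈ bisect S a b (R.mid a b)) (hu : u ∈ s) (hv : v ∈ s) (huv : R.Bad u v) :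
    R.level u v < R.level a b ∨ ∃ t ∈ S, u ∈ t ∧ v ∈ t := by
  rcases mem_bisect.1 hs with h | ⟨t, ht, -, -, rfl⟩
  · exact Or.inr ⟨s, h.1, hu, hv⟩
  by_cases hum : u = R.mid a b
  · subst hum
    exact Or.inl (R.level_mid_lt a b v hab huv)
  by_cases hvm : v = R.mid a b
  · subst hvm
    rw [R.level_comm]
    exact Or.inl (R.level_mid_lt a b u hab (R.symm _ _ huv))
  exact Or.inr ⟨t, ht, Finset.mem_of_mem_insert_of_ne hu hum,
    Finset.mem_of_mem_insert_of_ne hv hvm⟩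

theorem card_badEdges_bisect_lt (hab : (a, b) ∈ R.badEdges S j) :
    (R.badEdges (bisect S a b (R.mid a b)) j).card < (R.badEdges S j).card := by
  obtain ⟨-, hbad, hj⟩ := R.mem_badEdges.1 hab
  refine Finset.card_lt_card ((Finset.ssubset_iff_of_subset ?_).2 ⟨(a, b), hab, ?_⟩)
  · rintro ⟨u, v⟩ huv
    rw [mem_badEdges] at huv ⊢
    obtain ⟨⟨s, hs, hu, hv⟩, huv, hl⟩ := huv
    exact ⟨(R.level_lt_or_edge_of_bisect hbad hs hu hv huv).resolve_left (hl.trans hj.symm).not_lt,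
      huv, hl⟩
  · rw [mem_badEdges]
    rintro ⟨⟨s, hs, ha, hb⟩, -⟩
    have hm := R.mid_mem a b hbad
    exact not_subset_of_mem_bisect (ne_left_of_mem_openSegment (R.ne a b hbad) hm)
      (ne_right_of_mem_openSegment (R.ne a b hbad) hm) hs
      (by simp [Finset.insert_subset_iff, ha, hb])

theorem exists_refines_level_lt_of_le (hS : IsComplex S)
    (hle : ∀ s ∈ S, ∀ a ∈ s, ∀ b ∈ s, R.Bad a b → R.level a b ≤ j) :
    ∃ S', IsComplex S' ∧ Refines r n S' S ∧
      ∀ s ∈ S', ∀ a ∈ s, ∀ b ∈ s, R.Bad a b → R.level a b < j := by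
  induction hN : (R.badEdges S j).card using Nat.strong_induction_on generalizing S with
  | _ N ih =>
    rcases (R.badEdges S j).eq_empty_or_nonempty with hempty | ⟨⟨a, b⟩, hedge⟩
    · refine ⟨S, hS, Refines.refl r n S, fun s hs a ha b hb hab => ?_⟩
      refine (hle s hs a ha b hb hab).lt_of_ne fun hj => ?_
      have hedge := R.mem_badEdges.2 ⟨⟨s, hs, ha, hb⟩, hab, hj⟩
      simp [hempty] at hedge
    · obtain ⟨⟨s, hs, ha, hb⟩, hab, hj⟩ := R.mem_badEdges.1 hedge
      have habS : {a, b} ∈ S := hS.down s hs _ (by simp [Finset.insert_subset_iff, ha, hb])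
      have hne := R.ne a b hab
      have hmid := R.mid_mem a b hab
      obtain ⟨S', hS', hre, hlt⟩ := ih _ (hN ▸ R.card_badEdges_bisect_lt hedge)
        (hS.bisect hne habS hmid) (fun t ht u hu v hv huv => by
          rcases R.level_lt_or_edge_of_bisect hab ht hu hv huv with h | ⟨t, ht, hu, hv⟩
          · exact h.le.trans hj.le
          · exact hle t ht u hu v hv huv) rfl
      exact ⟨S', hS', hre.trans (refines_bisect hS hne habS hmid (R.rank_le a b hab)
        (R.rank_le b a (R.symm a b hab))), hlt⟩

theorem exists_refines_forall_not_bad (hS : IsComplex S) :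
    ∃ S', IsComplex S' ∧ Refines r n S' S ∧ ∀ s ∈ S', ∀ a ∈ s, ∀ b ∈ s, ¬ R.Bad a b := by
  have main : ∀ j S, IsComplex S → (∀ s ∈ S, ∀ a ∈ s, ∀ b ∈ s, R.Bad a b → R.level a b < j) →
      ∃ S', IsComplex S' ∧ Refines r n S' S ∧ ∀ s ∈ S', ∀ a ∈ s, ∀ b ∈ s, ¬ R.Bad a b := by
    intro j
    induction j with
    | zero => exact fun S hS h => ⟨S, hS, Refines.refl r n S, fun s hs a ha b hb hab =>
        absurd (h s hs a ha b hb hab) (Nat.not_lt_zero _)⟩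
    | succ j ih =>
      intro S hS hlt
      obtain ⟨S₁, hS₁, hre₁, hlt₁⟩ := R.exists_refines_level_lt_of_le hS
        fun s hs a ha b hb hab => Nat.lt_succ_iff.1 (hlt s hs a ha b hb hab)
      obtain ⟨S₂, hS₂, hre₂, hnot⟩ := ih S₁ hS₁ hlt₁
      exact ⟨S₂, hS₂, hre₂.trans hre₁, hnot⟩
  refine main (((S.biUnion id) ×ˢ (S.biUnion id)).sup (fun p => R.level p.1 p.2) + 1) S hS
    fun s hs a ha b hb _ => Nat.lt_succ_iff.2 ?_
  exact Finset.le_sup (f := fun p : E × E => R.level p.1 p.2) (Finset.mk_mem_product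
    (Finset.mem_biUnion.2 ⟨s, hs, ha⟩) (Finset.mem_biUnion.2 ⟨s, hs, hb⟩))

end BisectionRule

end Bisection

section Cuts

variable {E V : Type*} [AddCommGroup E] [Module ℝ E] [AddCommGroup V] [Module ℝ V]

/-- The functional `ℓ` does not change sign on `C`. -/
def WeakSign (ℓ : E →ᵃ[ℝ] ℝ) (C : Set E) : Prop :=
  (∀ x ∈ C, ℓ x ≤ 0) ∨ (∀ x ∈ C, 0 ≤ ℓ x)

namespace WeakSign

variable {ℓ : E →ᵃ[ℝ] ℝ} {C C' : Set E}

theorem mono (h : WeakSign ℓ C) (hC : C' ⊆ C) : WeakSign ℓ C' :=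
  h.imp (fun h x hx => h x (hC hx)) (fun h x hx => h x (hC hx))

theorem convexHull (h : WeakSign ℓ C) : WeakSign ℓ (convexHull ℝ C) :=
  h.imp (fun h => convexHull_min h ((convex_Iic (0 : ℝ)).affine_preimage ℓ))
    (fun h => convexHull_min h ((convex_Ici (0 : ℝ)).affine_preimage ℓ))

theorem le_of_mem_support {w : E →₀ ℝ} (hw : IsWeight w) (h : WeakSign ℓ (w.support : Set E))
    (hle : ℓ (lc id w) ≤ 0) {v : E} (hv : v ∈ w.support) : ℓ v ≤ 0 := by
  rcases h with h | h
  · exact h v hv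
  · rw [affineMap_lc ℓ id hw.mass, lc_eq_sum subset_rfl] at hle
    by_contra! hlt
    exact hle.not_gt (Finset.sum_pos' (fun u hu => mul_nonneg (hw.nonneg u) (h u hu))
      ⟨v, hv, mul_pos (hw.pos hv) hlt⟩)

theorem of_forall_mul_nonneg {s : Set E} (h : ∀ a ∈ s, ∀ b ∈ s, ¬ ℓ a * ℓ b < 0) :
    WeakSign ℓ s := by
  by_cases hle : ∀ v ∈ s, ℓ v ≤ 0
  · exact Or.inl hle
  push Not at hle
  obtain ⟨a, ha, hpos⟩ := hle
  refine Or.inr fun b hb => ?_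
  by_contra! hneg
  exact h a ha b hb (mul_neg_of_pos_of_neg hpos hneg)

end WeakSign

theorem div_sub_mem_Ioo {x y : ℝ} (h : x * y < 0) : x / (x - y) ∈ Ioo (0 : ℝ) 1 := by
  rcases mul_neg_iff.1 h with ⟨hx, hy⟩ | ⟨hx, hy⟩
  · exact ⟨div_pos hx (by linarith), (div_lt_one (by linarith)).2 (by linarith)⟩
  · exact ⟨div_pos_of_neg_of_neg hx (by linarith),
      (div_lt_one_of_neg (by linarith)).2 (by linarith)⟩

theorem affineMap_lineMap_div_sub {ℓ : E →ᵃ[ℝ] ℝ} {a b : E} (h : ℓ a * ℓ b < 0) :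
    ℓ (AffineMap.lineMap a b (ℓ a / (ℓ a - ℓ b))) = 0 := by
  have hne : ℓ a - ℓ b ≠ 0 := fun h0 => by
    rw [sub_eq_zero.1 h0] at h
    exact h.not_ge (mul_self_nonneg _)
  rw [AffineMap.apply_lineMap, AffineMap.lineMap_apply_ring]
  field_simp
  ring

/-- Cut the edges of rank at most `n` whose ends are strictly separated by the zero set of `ℓ`,
where they meet it. -/
noncomputable def signRule (r : E → ℕ) (n : ℕ) (ℓ : E →ᵃ[ℝ] ℝ) : BisectionRule r n where
  Bad a b := r a ≤ n ∧ r b ≤ n ∧ ℓ a * ℓ b < 0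
  level _ _ := 0
  mid a b := AffineMap.lineMap a b (ℓ a / (ℓ a - ℓ b))
  symm _ _ h := ⟨h.2.1, h.1, by simpa only [mul_comm] using h.2.2⟩
  level_comm _ _ := rfl
  rank_le _ _ h := h.1
  ne := by
    rintro a _ h rfl
    exact h.2.2.not_ge (mul_self_nonneg _)
  mid_mem a b h := by
    rw [openSegment_eq_image_lineMap]
    exact ⟨_, div_sub_mem_Ioo h.2.2, rfl⟩
  level_mid_lt a b c h h' := by simp [affineMap_lineMap_div_sub h.2.2] at h'

theorem exists_refines_weakSign (r : E → ℕ) (n : ℕ) (Λ : Finset (E →ᵃ[ℝ] ℝ))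
    {S : Finset (Finset E)} (hS : IsComplex S) :
    ∃ S', IsComplex S' ∧ Refines r n S' S ∧
      ∀ ℓ ∈ Λ, ∀ s ∈ S', (∀ v ∈ s, r v ≤ n) → WeakSign ℓ (convexHull ℝ (s : Set E)) := by
  induction Λ using Finset.induction_on with
  | empty => exact ⟨S, hS, Refines.refl r n S, by simp⟩
  | insert ℓ Λ _ ih =>
    obtain ⟨S₁, hS₁, hre₁, hΛ⟩ := ih
    obtain ⟨S₂, hS₂, hre₂, hℓ⟩ := (signRule r n ℓ).exists_refines_forall_not_bad hS₁
    refine ⟨S₂, hS₂, hre₂.trans hre₁, fun ℓ' hℓ' s hs hr => ?_⟩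
    rcases Finset.mem_insert.1 hℓ' with rfl | h
    · exact (WeakSign.of_forall_mul_nonneg fun a ha b hb hab =>
        hℓ s hs a ha b hb ⟨hr a ha, hr b hb, hab⟩).convexHull
    · obtain ⟨t, ht, hrt, hst⟩ := hre₂.exists_face n le_rfl s hs hr
      exact (hΛ ℓ' h t ht hrt).mono hst

theorem exists_affineBasis {s : Set E} (hs : AffineIndependent ℝ ((↑) : s → E)) :
    ∃ (t : Set E) (b : AffineBasis t ℝ E), s ⊆ t ∧ ∀ i, b i = i := by
  obtain ⟨t, hst, ht, htop⟩ := exists_subset_affineIndependent_affineSpan_eq_top hs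
  exact ⟨t, ⟨(↑), ht, by simpa using htop⟩, hst, fun _ => rfl⟩

theorem exists_affineMap_eq {s : Finset E} (hs : AffineIndependent ℝ ((↑) : s → E))
    (φ : E → V) : ∃ A : E →ᵃ[ℝ] V, ∀ u ∈ s, A u = φ u := by
  obtain ⟨t, b, hst, hb⟩ := exists_affineBasis (s := (s : Set E)) hs
  refine ⟨(Fintype.linearCombination ℝ fun u : s => φ u).toAffineMap.comp
    (AffineMap.pi fun u : s => b.coord ⟨u, hst u.2⟩), fun v hv => ?_⟩
  have hcoord (u : s) : b.coord ⟨u, hst u.2⟩ v = if u = ⟨v, hv⟩ then 1 else 0 := by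
    simpa [hb, Subtype.ext_iff] using b.coord_apply ⟨u, hst u.2⟩ ⟨v, hst hv⟩
  simp [Fintype.linearCombination_apply, hcoord]

theorem exists_convexHull_eq_halfspaces [FiniteDimensional ℝ E] {s : Finset E}
    (hs : AffineIndependent ℝ ((↑) : s → E)) :
    ∃ Λ : Finset (E →ᵃ[ℝ] ℝ), convexHull ℝ (s : Set E) = {x | ∀ ℓ ∈ Λ, ℓ x ≤ 0} := by
  obtain ⟨t, b, hst, hb⟩ := exists_affineBasis (s := (s : Set E)) hs
  have : Finite t := finite_of_fin_dim_affineIndependent ℝ b.ind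
  have := Fintype.ofFinite t
  refine ⟨Finset.univ.image (fun i => -b.coord i) ∪
    (Finset.univ.filter fun i : t => (i : E) ∉ s).image b.coord, subset_antisymm ?_ ?_⟩
  · refine convexHull_min (fun u hu => ?_) ?_
    · have hcoord (i : t) : b.coord i u = if (i : E) = u then 1 else 0 := by
        simpa [hb, Subtype.ext_iff] using b.coord_apply i ⟨u, hst hu⟩
      simp only [mem_ofPred_eq, Finset.mem_union, Finset.mem_image, Finset.mem_filter,
        Finset.mem_univ, true_and]
      rintro ℓ (⟨i, rfl⟩ | ⟨i, hi, rfl⟩)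
      · rw [AffineMap.coe_neg, Pi.neg_apply, hcoord]
        split_ifs <;> norm_num
      · rw [hcoord, if_neg (by rintro rfl; exact hi hu)]
    · simp only [ofPred_forall]
      exact convex_iInter₂ fun ℓ _ => (convex_Iic (0 : ℝ)).affine_preimage ℓ
  · intro x hx
    have hpos (i : t) : 0 ≤ b.coord i x := by
      simpa using hx (-b.coord i) (by simp)
    have hzero (i : t) (hi : (i : E) ∉ s) : b.coord i x = 0 :=
      le_antisymm (hx _ (Finset.mem_union_right _ (Finset.mem_image_of_mem _ (by simp [hi]))))
        (hpos i)
    have hsum : ∑ i ∈ Finset.univ.filter fun i : t => (i : E) ∈ s, b.coord i x = 1 := by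
      rw [← b.sum_coord_apply_eq_one x]
      exact Finset.sum_filter_of_ne fun i _ hi => not_imp_comm.1 (hzero i) hi
    have hx : ∑ i ∈ Finset.univ.filter fun i : t => (i : E) ∈ s, b.coord i x • (i : E) = x := by
      conv_rhs => rw [← b.linear_combination_coord_eq_self x]
      simp only [hb]
      refine Finset.sum_filter_of_ne fun i _ hi => not_imp_comm.1 (hzero i) fun h => hi ?_
      rw [h, zero_smul]
    rw [← hx]
    exact (convex_convexHull ℝ _).sum_mem (fun i _ => hpos i) hsum
      fun i hi => subset_convexHull ℝ _ (Finset.mem_filter.1 hi).2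

end Cuts

section Separation

variable {E : Type*} [NormedAddCommGroup E] [NormedSpace ℝ E]

theorem exists_affineMap_neg_pos {x y : E} (hxy : x ≠ y) :
    ∃ ℓ : E →ᵃ[ℝ] ℝ, ℓ x < 0 ∧ 0 < ℓ y := by
  obtain ⟨f, hf⟩ := geometric_hahn_banach_point_point hxy
  refine ⟨(f : E →ₗ[ℝ] ℝ).toAffineMap - AffineMap.const ℝ E ((f x + f y) / 2), ?_, ?_⟩
  · simp only [AffineMap.coe_sub, LinearMap.coe_toAffineMap, ContinuousLinearMap.coe_coe,
      AffineMap.coe_const, Pi.sub_apply, Function.const_apply]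
    linarith
  · simp only [AffineMap.coe_sub, LinearMap.coe_toAffineMap, ContinuousLinearMap.coe_coe,
      AffineMap.coe_const, Pi.sub_apply, Function.const_apply]
    linarith

theorem exists_finset_separating [FiniteDimensional ℝ E] {Q : Set (E × E)} (hQ : IsCompact Q)
    (hne : ∀ p ∈ Q, p.1 ≠ p.2) :
    ∃ Λ : Finset (E →ᵃ[ℝ] ℝ), ∀ C : Set E, (∀ ℓ ∈ Λ, WeakSign ℓ C) →
      ∀ x ∈ C, ∀ y ∈ C, (x, y) ∉ Q := by
  choose! ℓ hℓ using fun p hp => exists_affineMap_neg_pos (hne p hp)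
  obtain ⟨t, -, ht⟩ := hQ.elim_nhds_subcover (fun p => {q : E × E | ℓ p q.1 < 0 ∧ 0 < ℓ p q.2})
    (fun p hp => by
      have hc : Continuous (ℓ p) := AffineMap.continuous_of_finiteDimensional _
      exact ((isOpen_lt (hc.comp continuous_fst) continuous_const).inter
        (isOpen_lt continuous_const (hc.comp continuous_snd))).mem_nhds (hℓ p hp))
  refine ⟨t.image ℓ, fun C hC x hx y hy hxy => ?_⟩
  obtain ⟨p, hp, hxneg, hypos⟩ := mem_iUnion₂.1 (ht hxy)
  rcases hC (ℓ p) (Finset.mem_image_of_mem _ hp) with h | h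
  · exact (h y hy).not_gt hypos
  · exact (h x hx).not_gt hxneg

end Separation

section Types

variable {ι F : Type*} {I : Finset ι} {P : ι → Set F} {x : F} {i : ι}

/-- The type of a point `x` with respect to a finite family of sets: the members containing `x`. -/
noncomputable def typeAt (I : Finset ι) (P : ι → Set F) (x : F) : Finset ι :=
  I.filter fun i => x ∈ P i

theorem mem_typeAt : i ∈ typeAt I P x ↔ i ∈ I ∧ x ∈ P i := Finset.mem_filter

theorem card_typeAt_le : (typeAt I P x).card ≤ I.card :=
  Finset.card_le_card (Finset.filter_subset _ _)

variable [AddCommGroup F] [Module ℝ F] {Λ : ι → Finset (F →ᵃ[ℝ] ℝ)} {S S' : Finset (Finset F)}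
  {s : Finset F}

/-- The half-spaces defined by `Λ` cut out the members of the family `P`. -/
def IsCutOut (I : Finset ι) (P : ι → Set F) (Λ : ι → Finset (F →ᵃ[ℝ] ℝ)) : Prop :=
  ∀ i ∈ I, P i = {x | ∀ ℓ ∈ Λ i, ℓ x ≤ 0}

/-- No functional in `Λ` changes sign on a face of `S`. -/
def IsCut (I : Finset ι) (Λ : ι → Finset (F →ᵃ[ℝ] ℝ)) (S : Finset (Finset F)) : Prop :=
  ∀ i ∈ I, ∀ ℓ ∈ Λ i, ∀ s ∈ S, WeakSign ℓ (convexHull ℝ (s : Set F))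

/-- The types of the points of a face of `S` form a chain. -/
def IsChainTyped (I : Finset ι) (P : ι → Set F) (S : Finset (Finset F)) : Prop :=
  ∀ s ∈ S, ∀ x ∈ convexHull ℝ (s : Set F), ∀ y ∈ convexHull ℝ (s : Set F),
    typeAt I P x ⊆ typeAt I P y ∨ typeAt I P y ⊆ typeAt I P x

theorem IsCutOut.convex (h : IsCutOut I P Λ) (hi : i ∈ I) : Convex ℝ (P i) := by
  simp only [h i hi, ofPred_forall]
  exact convex_iInter₂ fun ℓ _ => (convex_Iic (0 : ℝ)).affine_preimage ℓ

namespace IsCut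

theorem mem_iff (hS : IsCut I Λ S) (h : IsCutOut I P Λ) (hi : i ∈ I) {w : F →₀ ℝ}
    (hw : IsWeight w) (hs : s ∈ S) (hws : w.support ⊆ s) :
    lc id w ∈ P i ↔ ∀ v ∈ w.support, v ∈ P i := by
  refine ⟨fun hx v hv => ?_, hw.lc_mem (h.convex hi)⟩
  rw [h i hi] at hx ⊢
  exact fun ℓ hℓ => ((hS i hi ℓ hℓ s hs).mono fun u hu =>
    subset_convexHull ℝ _ (hws hu)).le_of_mem_support hw (hx ℓ hℓ) hv

theorem mem_typeAt_lc (hS : IsCut I Λ S) (h : IsCutOut I P Λ) {w : F →₀ ℝ} (hw : IsWeight w)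
    (hs : s ∈ S) (hws : w.support ⊆ s) :
    i ∈ typeAt I P (lc id w) ↔ ∀ v ∈ w.support, i ∈ typeAt I P v := by
  simp only [mem_typeAt]
  constructor
  · rintro ⟨hi, hx⟩ v hv
    exact ⟨hi, (hS.mem_iff h hi hw hs hws).1 hx v hv⟩
  · intro hv
    obtain ⟨v, hvs⟩ := hw.support_nonempty
    have hi := (hv v hvs).1
    exact ⟨hi, (hS.mem_iff h hi hw hs hws).2 fun v hvs => (hv v hvs).2⟩

theorem typeAt_midpoint (hS : IsCut I Λ S) (h : IsCutOut I P Λ) (hs : s ∈ S) {a b : F}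
    (ha : a ∈ s) (hb : b ∈ s) :
    typeAt I P (midpoint ℝ a b) = typeAt I P a ∩ typeAt I P b := by
  ext i
  simp only [Finset.mem_inter, mem_typeAt]
  suffices i ∈ I → (midpoint ℝ a b ∈ P i ↔ a ∈ P i ∧ b ∈ P i) by tauto
  intro hi
  refine ⟨fun hm => ?_, fun hab => (h.convex hi).midpoint_mem hab.1 hab.2⟩
  simp only [h i hi, mem_ofPred_eq, ← forall₂_and] at hm ⊢
  intro ℓ hℓ
  have hle := hm ℓ hℓ
  rw [AffineMap.map_midpoint, midpoint_eq_smul_add, smul_eq_mul, invOf_eq_inv] at hle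
  rcases hS i hi ℓ hℓ s hs with hsgn | hsgn <;>
  · have hℓa := hsgn a (subset_convexHull ℝ _ ha)
    have hℓb := hsgn b (subset_convexHull ℝ _ hb)
    constructor <;> linarith

theorem exists_typeAt_eq (hS : IsCut I Λ S) (h : IsCutOut I P Λ) (hs : s ∈ S)
    (hchain : ∀ a ∈ s, ∀ b ∈ s, typeAt I P a ⊆ typeAt I P b ∨ typeAt I P b ⊆ typeAt I P a)
    (hx : x ∈ convexHull ℝ (s : Set F)) : ∃ v ∈ s, typeAt I P x = typeAt I P v := by
  obtain ⟨w, hw, hws, rfl⟩ := mem_convexHull_iff_weight.1 hx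
  obtain ⟨v, hv, hmin⟩ := w.support.exists_min_image (fun v => (typeAt I P v).card)
    hw.support_nonempty
  refine ⟨v, hws hv, ?_⟩
  ext i
  rw [hS.mem_typeAt_lc h hw hs hws]
  refine ⟨fun hi => hi v hv, fun hi u hu => ?_⟩
  rcases hchain v (hws hv) u (hws hu) with hsub | hsub
  · exact hsub hi
  · rwa [Finset.eq_of_subset_of_card_le hsub (hmin u hu)]

theorem of_refines {r : F → ℕ} {n : ℕ} (h : IsCut I Λ S) (hr : Refines r n S' S) :
    IsCut I Λ S' := by
  intro i hi ℓ hℓ s hs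
  obtain ⟨t, ht, hst⟩ := hr.exists_convexHull_subset hs
  exact (h i hi ℓ hℓ t ht).mono hst

end IsCut

theorem IsChainTyped.of_refines {r : F → ℕ} {n : ℕ} (h : IsChainTyped I P S)
    (hr : Refines r n S' S) : IsChainTyped I P S' := by
  intro s hs x hx y hy
  obtain ⟨t, ht, hst⟩ := hr.exists_convexHull_subset hs
  exact h t ht x (hst hx) y (hst hy)

theorem exists_isCut (Λ : ι → Finset (F →ᵃ[ℝ] ℝ)) (I : Finset ι) (hS : IsComplex S) :
    ∃ S', IsComplex S' ∧ Refines (fun _ => 0) 0 S' S ∧ IsCut I Λ S' := by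
  obtain ⟨S', hS', hr, h⟩ := exists_refines_weakSign (fun _ => 0) 0 (I.biUnion Λ) hS
  exact ⟨S', hS', hr, fun i hi ℓ hℓ s hs =>
    h ℓ (Finset.mem_biUnion.2 ⟨i, hi, hℓ⟩) s hs fun _ _ => le_rfl⟩

/-- Cut the edges whose ends have incomparable types at their midpoints. The last condition on a
bad edge holds on the faces which are cut by `P`; it makes the type of the new vertex smaller. -/
noncomputable def chainRule (I : Finset ι) (P : ι → Set F) :
    BisectionRule (fun _ : F => 0) 0 where
  Bad a b := ¬ typeAt I P a ⊆ typeAt I P b ∧ ¬ typeAt I P b ⊆ typeAt I P a ∧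
    typeAt I P (midpoint ℝ a b) = typeAt I P a ∩ typeAt I P b
  level a b := (typeAt I P a ∩ typeAt I P b).card
  mid a b := midpoint ℝ a b
  symm a b h := ⟨h.2.1, h.1, by rw [midpoint_comm, Finset.inter_comm, h.2.2]⟩
  level_comm a b := by rw [Finset.inter_comm]
  rank_le _ _ _ := le_rfl
  ne := by
    rintro a _ h rfl
    exact h.1 subset_rfl
  mid_mem a b _ := by
    rw [openSegment_eq_image_lineMap]
    exact ⟨⅟2, by norm_num, rfl⟩
  level_mid_lt a b c h h' := by
    rw [← h.2.2]
    exact Finset.card_lt_card ⟨Finset.inter_subset_left,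
      fun hsub => h'.1 (hsub.trans Finset.inter_subset_right)⟩

theorem exists_isChainTyped (h : IsCutOut I P Λ) (hS : IsComplex S) (hcut : IsCut I Λ S) :
    ∃ S', IsComplex S' ∧ Refines (fun _ => 0) 0 S' S ∧ IsCut I Λ S' ∧ IsChainTyped I P S' := by
  obtain ⟨S', hS', hr, hnot⟩ := (chainRule I P).exists_refines_forall_not_bad hS
  have hcut' := hcut.of_refines hr
  have hchain : ∀ s ∈ S', ∀ a ∈ s, ∀ b ∈ s,
      typeAt I P a ⊆ typeAt I P b ∨ typeAt I P b ⊆ typeAt I P a := by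
    intro s hs a ha b hb
    by_contra! hcon
    exact hnot s hs a ha b hb ⟨hcon.1, hcon.2, hcut'.typeAt_midpoint h hs ha hb⟩
  refine ⟨S', hS', hr, hcut', fun s hs x hx y hy => ?_⟩
  obtain ⟨u, hu, hxu⟩ := hcut'.exists_typeAt_eq h hs (hchain s hs) hx
  obtain ⟨v, hv, hyv⟩ := hcut'.exists_typeAt_eq h hs (hchain s hs) hy
  rw [hxu, hyv]
  exact hchain s hs u hu v hv

theorem ne_of_typeAt_card_eq {W : Type*} {G : ι → F → W} {c : ι → ι → ι} (h : IsCutOut I P Λ)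
    (hcut : IsCut I Λ S) (hchain : IsChainTyped I P S) {n : ℕ} {j : ι} (hs : s ∈ S)
    (hrank : ∀ v ∈ s, (typeAt I P v).card ≤ n) (hc : c i j ∈ I)
    (hco : ∀ y ∈ P i, y ∈ P j → G i y = G j y → y ∈ P (c i j)) {q y : F}
    (hq : q ∈ convexHull ℝ (s : Set F) ∩ (P i ∩ P j)) (hy : y ∈ convexHull ℝ (s : Set F))
    (hyn : (typeAt I P y).card = n) (hyP : y ∉ P (c i j)) : G i q ≠ G j q := by
  intro heq
  obtain ⟨v, hv, hqv⟩ := hcut.exists_typeAt_eq h hs (fun a ha b hb =>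
    hchain s hs a (subset_convexHull ℝ _ ha) b (subset_convexHull ℝ _ hb)) hq.1
  have hqn : (typeAt I P q).card ≤ n := hqv ▸ hrank v hv
  have hsub : typeAt I P q ⊆ typeAt I P y :=
    (hchain s hs q hq.1 y hy).elim id fun hyq =>
      (Finset.eq_of_subset_of_card_le hyq (hyn ▸ hqn)).ge
  exact hyP (mem_typeAt.1 (hsub (mem_typeAt.2 ⟨hc, hco q hq.2.1 hq.2.2 heq⟩))).2

end Types

section Separated

variable {ι F W : Type*} [AddCommGroup F] [Module ℝ F] [AddCommGroup W] [Module ℝ W]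

/-- On the faces of `S` whose vertices lie in at most `n` members of `P`, the maps `G i` and `G j`
are separated as soon as some point of `P i ∩ P j` lying in exactly `n` members of `P` is outside
`P (c i j)`. -/
def IsSeparated (I : Finset ι) (P : ι → Set F) (G : ι → F → W) (c : ι → ι → ι) (n : ℕ)
    (S : Finset (Finset F)) : Prop :=
  ∀ s ∈ S, (∀ v ∈ s, (typeAt I P v).card ≤ n) → ∀ i ∈ I, ∀ j ∈ I,
    (∃ y ∈ convexHull ℝ (s : Set F) ∩ (P i ∩ P j), (typeAt I P y).card = n ∧ y ∉ P (c i j)) →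
    Disjoint (convexHull ℝ (G i '' (convexHull ℝ (s : Set F) ∩ (P i ∩ P j))))
      (convexHull ℝ (G j '' (convexHull ℝ (s : Set F) ∩ (P i ∩ P j))))

theorem IsSeparated.of_refines {I : Finset ι} {P : ι → Set F} {G : ι → F → W} {c : ι → ι → ι}
    {n n' : ℕ} {S S' : Finset (Finset F)} (h : IsSeparated I P G c n' S) (hn : n ≤ n')
    (hr : Refines (fun v => (typeAt I P v).card) n S' S) : IsSeparated I P G c n' S' := by
  intro s hs hsr i hi j hj ⟨y, hy, hyn, hyP⟩
  obtain ⟨t, ht, htr, hst⟩ := hr.exists_face n' hn s hs hsr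
  have hsub := inter_subset_inter_left (P i ∩ P j) hst
  exact (h t ht htr i hi j hj ⟨y, hsub hy, hyn, hyP⟩).mono
    (convexHull_mono (image_mono hsub)) (convexHull_mono (image_mono hsub))

end Separated

section Separation

variable {ι F W : Type*} [NormedAddCommGroup F] [NormedSpace ℝ F] [FiniteDimensional ℝ F]
  [NormedAddCommGroup W] [NormedSpace ℝ W]

theorem exists_finset_image_subset_ball {X : Type*} [PseudoMetricSpace X] {Q : Set F}
    (hQ : IsCompact Q) {G : F → X} (hG : ContinuousOn G Q) {ε : ℝ} (hε : 0 < ε) :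
    ∃ Λ : Finset (F →ᵃ[ℝ] ℝ), ∀ C ⊆ Q, (∀ ℓ ∈ Λ, WeakSign ℓ C) →
      ∀ y ∈ C, G '' C ⊆ Metric.ball (G y) ε := by
  have hdist : ContinuousOn (fun p : F × F => dist (G p.1) (G p.2)) (Q ×ˢ Q) :=
    continuous_dist.comp_continuousOn ((hG.comp continuousOn_fst fun _ hp => hp.1).prodMk
      (hG.comp continuousOn_snd fun _ hp => hp.2))
  have hclosed :=
    hdist.preimage_isClosed_of_isClosed (hQ.prod hQ).isClosed (isClosed_Ici (a := ε))
  obtain ⟨Λ, hΛ⟩ := exists_finset_separating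
    ((hQ.prod hQ).of_isClosed_subset hclosed inter_subset_left) fun p hp heq => by
      have hle : ε ≤ dist (G p.1) (G p.2) := hp.2
      rw [heq, dist_self] at hle
      exact hle.not_gt hε
  refine ⟨Λ, fun C hC hs y hy => ?_⟩
  rintro _ ⟨x, hx, rfl⟩
  rw [Metric.mem_ball]
  by_contra! hle
  exact hΛ C hs x hx y hy ⟨⟨hC hx, hC hy⟩, hle⟩

theorem exists_finset_disjoint {Q : Set F} (hQ : IsCompact Q) {G G' : F → W}
    (hG : ContinuousOn G Q) (hG' : ContinuousOn G' Q) (hne : ∀ q ∈ Q, G q ≠ G' q) :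
    ∃ Λ : Finset (F →ᵃ[ℝ] ℝ), ∀ C ⊆ Q, (∀ ℓ ∈ Λ, WeakSign ℓ C) →
      Disjoint (convexHull ℝ (G '' C)) (convexHull ℝ (G' '' C)) := by
  obtain ⟨η, hη, hdist⟩ : ∃ η > 0, ∀ q ∈ Q, η ≤ dist (G q) (G' q) :=
    hQ.exists_forall_le' (continuous_dist.comp_continuousOn (hG.prodMk hG'))
      fun q hq => dist_pos.2 (hne q hq)
  obtain ⟨Λ, hΛ⟩ := exists_finset_image_subset_ball hQ hG (half_pos hη)
  obtain ⟨Λ', hΛ'⟩ := exists_finset_image_subset_ball hQ hG' (half_pos hη)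
  refine ⟨Λ ∪ Λ', fun C hC hs => ?_⟩
  rcases C.eq_empty_or_nonempty with rfl | ⟨y, hy⟩
  · simp
  have hball := hΛ C hC (fun ℓ hℓ => hs ℓ (Finset.mem_union_left _ hℓ)) y hy
  have hball' := hΛ' C hC (fun ℓ hℓ => hs ℓ (Finset.mem_union_right _ hℓ)) y hy
  refine (Metric.ball_disjoint_ball ?_).mono (convexHull_min hball (convex_ball _ _))
    (convexHull_min hball' (convex_ball _ _))
  rw [add_halves]
  exact hdist y (hC hy)

variable {I : Finset ι} {P : ι → Set F} {Λ : ι → Finset (F →ᵃ[ℝ] ℝ)} {G : ι → F → W}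
  {c : ι → ι → ι} {S : Finset (Finset F)}

theorem exists_isSeparated_step (h : IsCutOut I P Λ) (hcpt : ∀ i ∈ I, IsCompact (P i))
    (hG : ∀ i ∈ I, ContinuousOn (G i) (P i)) (hc : ∀ i ∈ I, ∀ j ∈ I, c i j ∈ I)
    (hco : ∀ i ∈ I, ∀ j ∈ I, ∀ y ∈ P i, y ∈ P j → G i y = G j y → y ∈ P (c i j)) (n : ℕ)
    (hS : IsComplex S) (hcut : IsCut I Λ S) (hchain : IsChainTyped I P S) :
    ∃ S', IsComplex S' ∧ Refines (fun v => (typeAt I P v).card) n S' S ∧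
      IsSeparated I P G c n S' := by
  have hsep : ∀ s ∈ S, (∀ v ∈ s, (typeAt I P v).card ≤ n) → ∀ i ∈ I, ∀ j ∈ I,
      (∃ y ∈ convexHull ℝ (s : Set F) ∩ (P i ∩ P j), (typeAt I P y).card = n ∧ y ∉ P (c i j)) →
      ∃ Λ' : Finset (F →ᵃ[ℝ] ℝ), ∀ C ⊆ convexHull ℝ (s : Set F) ∩ (P i ∩ P j),
        (∀ ℓ ∈ Λ', WeakSign ℓ C) →
        Disjoint (convexHull ℝ (G i '' C)) (convexHull ℝ (G j '' C)) := by
    rintro s hs hrank i hi j hj ⟨y, hy, hyn, hyP⟩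
    have hQ : IsCompact (convexHull ℝ (s : Set F) ∩ (P i ∩ P j)) :=
      (s.finite_toSet.isCompact_convexHull (𝕜 := ℝ)).inter ((hcpt i hi).inter (hcpt j hj))
    exact exists_finset_disjoint hQ ((hG i hi).mono fun q hq => hq.2.1)
      ((hG j hj).mono fun q hq => hq.2.2) fun q hq => ne_of_typeAt_card_eq h hcut hchain hs hrank
        (hc i hi j hj) (hco i hi j hj) hq hy.1 hyn hyP
  choose! Λ' hΛ' using hsep
  obtain ⟨S', hS', hr, hsign⟩ := exists_refines_weakSign (fun v => (typeAt I P v).card) n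
    (S.biUnion fun s => I.biUnion fun i => I.biUnion fun j => Λ' s i j) hS
  refine ⟨S', hS', hr, fun s hs hsr i hi j hj ⟨y, hy, hyn, hyP⟩ => ?_⟩
  obtain ⟨t, ht, htr, hst⟩ := hr.exists_face n le_rfl s hs hsr
  have hsub := inter_subset_inter_left (P i ∩ P j) hst
  refine hΛ' t ht htr i hi j hj ⟨y, hsub hy, hyn, hyP⟩ _ hsub fun ℓ hℓ =>
    (hsign ℓ ?_ s hs hsr).mono inter_subset_left
  simp only [Finset.mem_biUnion]
  exact ⟨t, ht, i, hi, j, hj, hℓ⟩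

theorem exists_isSeparated (h : IsCutOut I P Λ) (hcpt : ∀ i ∈ I, IsCompact (P i))
    (hG : ∀ i ∈ I, ContinuousOn (G i) (P i)) (hc : ∀ i ∈ I, ∀ j ∈ I, c i j ∈ I)
    (hco : ∀ i ∈ I, ∀ j ∈ I, ∀ y ∈ P i, y ∈ P j → G i y = G j y → y ∈ P (c i j))
    (hS : IsComplex S) :
    ∃ S', IsComplex S' ∧ space S' = space S ∧ IsCut I Λ S' ∧ IsChainTyped I P S' ∧
      ∀ n, IsSeparated I P G c n S' := by
  obtain ⟨S₁, hS₁, hr₁, hcut₁⟩ := exists_isCut Λ I hS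
  obtain ⟨S₂, hS₂, hr₂, hcut₂, hchain₂⟩ := exists_isChainTyped h hS₁ hcut₁
  obtain ⟨S', hS', hsp, hcut, hchain, hsep⟩ : ∃ S', IsComplex S' ∧ space S' = space S ∧
      IsCut I Λ S' ∧ IsChainTyped I P S' ∧ ∀ n, 0 ≤ n → IsSeparated I P G c n S' := by
    refine Nat.decreasingInduction' (m := 0) (n := I.card + 1)
      (P := fun m => ∃ S', IsComplex S' ∧ space S' = space S ∧ IsCut I Λ S' ∧
        IsChainTyped I P S' ∧ ∀ n, m ≤ n → IsSeparated I P G c n S') ?_ (Nat.zero_le _) ?_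
    · rintro m - - ⟨S₃, hS₃, hsp, hcut₃, hchain₃, hsep₃⟩
      obtain ⟨S₄, hS₄, hr₄, hsep₄⟩ :=
        exists_isSeparated_step h hcpt hG hc hco m hS₃ hcut₃ hchain₃
      refine ⟨S₄, hS₄, hr₄.space_eq.trans hsp, hcut₃.of_refines hr₄, hchain₃.of_refines hr₄,
        fun n hn => ?_⟩
      rcases hn.eq_or_lt with rfl | hlt
      exacts [hsep₄, (hsep₃ n hlt).of_refines hn hr₄]
    · refine ⟨S₂, hS₂, hr₂.space_eq.trans hr₁.space_eq, hcut₂, hchain₂, fun n hn => ?_⟩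
      rintro s - - i - j - ⟨y, -, hyn, -⟩
      exact absurd (hyn ▸ card_typeAt_le) (Nat.not_le_of_lt hn)
  exact ⟨S', hS', hsp, hcut, hchain, fun n => hsep n n.zero_le⟩

end Separation

section LinearOn

variable {E V : Type*} [AddCommGroup E] [Module ℝ E] [AddCommGroup V] [Module ℝ V]
  {S : Finset (Finset E)} {s : Finset E} {f h : E → V}

/-- The map `h` is linear in barycentric weights on the faces of `S`. -/
def LinearOn (S : Finset (Finset E)) (h : E → V) : Prop :=
  ∀ w : E →₀ ℝ, IsWeight w → w.support ∈ S → h (lc id w) = lc h w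

namespace LinearOn

theorem congr (hlin : LinearOn S h) (hS : IsComplex S) (hfh : EqOn f h (space S)) :
    LinearOn S f := by
  intro w hw hs
  rw [hfh ⟨w, hw, hs, rfl⟩, hlin w hw hs]
  exact lc_congr fun v hv => (hfh (hS.mem_space hs hv)).symm

theorem exists_weight_of_support_mem_image (hlin : LinearOn S h) (hS : IsComplex S) {w : V →₀ ℝ}
    (hw : IsWeight w) (hs : w.support ∈ S.image (Finset.image h)) :
    ∃ u, IsWeight u ∧ u.support ∈ S ∧ u.mapDomain h = w ∧ lc id w = h (lc id u) := by
  obtain ⟨s, hsS, hsw⟩ := Finset.mem_image.1 hs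
  obtain ⟨u, hu, hus, rfl⟩ := hw.exists_mapDomain_eq hsw.ge
  have huS := hS.down s hsS _ hus
  exact ⟨u, hu, huS, rfl, (lc_mapDomain h id u).trans (hlin u hu huS).symm⟩

theorem isComplex_image (hlin : LinearOn S h) (hS : IsComplex S) (hinj : InjOn h (space S)) :
    IsComplex (S.image (Finset.image h)) where
  down s hs t hts := by
    obtain ⟨s, hsS, rfl⟩ := Finset.mem_image.1 hs
    obtain ⟨u, hu, rfl⟩ := Finset.subset_image_iff.1 hts
    exact Finset.mem_image_of_mem _ (hS.down s hsS u hu)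
  uniq w w' hw hw' hs hs' he := by
    obtain ⟨u, hu, huS, rfl, hx⟩ := hlin.exists_weight_of_support_mem_image hS hw hs
    obtain ⟨u', hu', huS', rfl, hx'⟩ := hlin.exists_weight_of_support_mem_image hS hw' hs'
    rw [hS.uniq u u' hu hu' huS huS' (hinj ⟨u, hu, huS, rfl⟩ ⟨u', hu', huS', rfl⟩
      (hx.symm.trans (he.trans hx')))]

theorem space_image (hlin : LinearOn S h) (hS : IsComplex S) :
    space (S.image (Finset.image h)) = h '' space S := by
  ext y
  constructor
  · rintro ⟨w, hw, hs, rfl⟩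
    obtain ⟨u, hu, huS, -, hx⟩ := hlin.exists_weight_of_support_mem_image hS hw hs
    exact ⟨_, ⟨u, hu, huS, rfl⟩, hx.symm⟩
  · rintro ⟨_, ⟨u, hu, huS, rfl⟩, rfl⟩
    refine ⟨u.mapDomain h, hu.mapDomain h, ?_, (lc_mapDomain h id u).trans (hlin u hu huS).symm⟩
    rw [hu.support_mapDomain]
    exact Finset.mem_image_of_mem _ huS

theorem of_leftInvOn (hlin : LinearOn S h) (hS : IsComplex S) {r : V → E}
    (hr : LeftInvOn r h (space S)) : LinearOn (S.image (Finset.image h)) r := by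
  intro w hw hs
  obtain ⟨u, hu, huS, rfl, hx⟩ := hlin.exists_weight_of_support_mem_image hS hw hs
  rw [hx, hr ⟨u, hu, huS, rfl⟩, lc_mapDomain]
  exact lc_congr fun v hv => (hr (hS.mem_space huS hv)).symm

theorem exists_affineMap (hlin : LinearOn S f) (hS : IsComplex S) (hs : s ∈ S) :
    ∃ A : E →ᵃ[ℝ] V, EqOn f A (convexHull ℝ (s : Set E)) := by
  obtain ⟨A, hA⟩ := exists_affineMap_eq (hS.affineIndependent hs) f
  refine ⟨A, fun x hx => ?_⟩
  obtain ⟨w, hw, hws, rfl⟩ := mem_convexHull_iff_weight.1 hx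
  rw [hlin w hw (hS.down s hs _ hws), affineMap_lc A id hw.mass]
  exact lc_congr fun v hv => (hA v (hws hv)).symm

end LinearOn

/-- The map `f` agrees with an affine map on every face of `S`. -/
def AffineOnFaces (S : Finset (Finset E)) (f : E → V) : Prop :=
  ∀ s ∈ S, ∃ A : E →ᵃ[ℝ] V, EqOn f A (convexHull ℝ (s : Set E))

namespace AffineOnFaces

theorem apply_lc (hf : AffineOnFaces S f) (hs : s ∈ S) {w : E →₀ ℝ} (hw : IsWeight w)
    (hws : (w.support : Set E) ⊆ convexHull ℝ (s : Set E)) : f (lc id w) = lc f w := by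
  obtain ⟨A, hA⟩ := hf s hs
  rw [hA (hw.lc_id_mem (convex_convexHull ℝ _) hws), affineMap_lc A id hw.mass]
  exact lc_congr fun v hv => (hA (hws hv)).symm

theorem linearOn_powerset (hf : AffineOnFaces S f) (hs : s ∈ S) : LinearOn s.powerset f :=
  fun _ hw hws => hf.apply_lc hs hw
    ((Finset.coe_subset.2 (Finset.mem_powerset.1 hws)).trans (subset_convexHull ℝ _))

theorem image_convexHull (hf : AffineOnFaces S f) (hs : s ∈ S) {t : Finset E}
    (ht : (t : Set E) ⊆ convexHull ℝ (s : Set E)) :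
    f '' convexHull ℝ (t : Set E) = convexHull ℝ (t.image f : Set V) := by
  obtain ⟨A, hA⟩ := hf s hs
  rw [(hA.mono (convexHull_min ht (convex_convexHull ℝ _))).image_eq, A.image_convexHull,
    Finset.coe_image, (hA.mono ht).image_eq]

theorem isComplex_image_powerset (hf : AffineOnFaces S f) (hS : IsComplex S) (hs : s ∈ S)
    (hinj : InjOn f (convexHull ℝ (s : Set E))) : IsComplex (s.powerset.image (Finset.image f)) :=
  (hf.linearOn_powerset hs).isComplex_image (isComplex_powerset (hS.affineIndependent hs))
    (by rwa [space_powerset])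

theorem affineIndependent_image (hf : AffineOnFaces S f) (hS : IsComplex S) (hs : s ∈ S)
    (hinj : InjOn f (convexHull ℝ (s : Set E))) : AffineIndependent ℝ ((↑) : s.image f → V) :=
  (hf.isComplex_image_powerset hS hs hinj).affineIndependent
    (Finset.mem_image_of_mem _ (Finset.mem_powerset_self s))

theorem exists_affineMap_leftInvOn (hf : AffineOnFaces S f) (hS : IsComplex S) (hs : s ∈ S)
    (hinj : InjOn f (convexHull ℝ (s : Set E))) :
    ∃ A : V →ᵃ[ℝ] E, LeftInvOn A f (convexHull ℝ (s : Set E)) := by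
  have hinv : LeftInvOn (Function.invFunOn f (convexHull ℝ (s : Set E))) f (space s.powerset) := by
    rw [space_powerset]
    exact hinj.leftInvOn_invFunOn
  obtain ⟨A, hA⟩ := ((hf.linearOn_powerset hs).of_leftInvOn
    (isComplex_powerset (hS.affineIndependent hs)) hinv).exists_affineMap
    (hf.isComplex_image_powerset hS hs hinj)
    (Finset.mem_image_of_mem _ (Finset.mem_powerset_self s))
  rw [space_powerset] at hinv
  refine ⟨A, fun x hx => ?_⟩
  rw [← hA (hf.image_convexHull hs (subset_convexHull ℝ _) ▸ mem_image_of_mem f hx), hinv hx]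

end AffineOnFaces

end LinearOn

section Pullback

variable {E F : Type*} [AddCommGroup E] [Module ℝ E]

/-- The inverse of `f` on the simplex spanned by `δ`. -/
noncomputable def sheet (f : E → F) (δ : Finset E) : F → E :=
  Function.invFunOn f (convexHull ℝ (δ : Set E))

/-- The image under `f` of the simplex spanned by `δ`. -/
def imageFace (f : E → F) (δ : Finset E) : Set F := f '' convexHull ℝ (δ : Set E)

/-- The lifts of the faces of `L` to the faces of `K`. -/
noncomputable def pullback (K : Finset (Finset E)) (L : Finset (Finset F)) (f : E → F) :
    Finset (Finset E) :=
  ((K ×ˢ L).filter fun p => (p.2 : Set F) ⊆ imageFace f p.1).image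
    fun p => p.2.image (sheet f p.1)

variable {K : Finset (Finset E)} {L : Finset (Finset F)} {f : E → F} {δ : Finset E}

theorem sheet_mem {y : F} (hy : y ∈ imageFace f δ) : sheet f δ y ∈ convexHull ℝ (δ : Set E) :=
  Function.invFunOn_mem hy

theorem apply_sheet {y : F} (hy : y ∈ imageFace f δ) : f (sheet f δ y) = y :=
  Function.invFunOn_eq hy

theorem sheet_apply (hinj : InjOn f (convexHull ℝ (δ : Set E))) {x : E}
    (hx : x ∈ convexHull ℝ (δ : Set E)) : sheet f δ (f x) = x :=
  hinj.leftInvOn_invFunOn hx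

theorem image_image_sheet {β : Finset F} (hβ : (β : Set F) ⊆ imageFace f δ) :
    (β.image (sheet f δ)).image f = β := by
  rw [Finset.image_image]
  exact (Finset.image_congr fun v hv => apply_sheet (hβ hv)).trans Finset.image_id

theorem image_sheet_image (hinj : InjOn f (convexHull ℝ (δ : Set E))) {u : Finset E}
    (hu : (u : Set E) ⊆ convexHull ℝ (δ : Set E)) : (u.image f).image (sheet f δ) = u := by
  rw [Finset.image_image]
  exact (Finset.image_congr fun v hv => sheet_apply hinj (hu hv)).trans Finset.image_id

theorem mem_pullback (hinj : ∀ δ ∈ K, InjOn f (convexHull ℝ (δ : Set E))) {u : Finset E} :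
    u ∈ pullback K L f ↔
      ∃ δ ∈ K, (u : Set E) ⊆ convexHull ℝ (δ : Set E) ∧ u.image f ∈ L := by
  simp only [pullback, Finset.mem_image, Finset.mem_filter, Finset.mem_product, Prod.exists]
  constructor
  · rintro ⟨δ, β, ⟨⟨hδ, hβ⟩, hsub⟩, rfl⟩
    refine ⟨δ, hδ, ?_, by rwa [image_image_sheet hsub]⟩
    rw [Finset.coe_image]
    rintro _ ⟨v, hv, rfl⟩
    exact sheet_mem (hsub hv)
  · rintro ⟨δ, hδ, hu, huL⟩
    refine ⟨δ, u.image f, ⟨⟨hδ, huL⟩, ?_⟩, image_sheet_image (hinj δ hδ) hu⟩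
    rw [Finset.coe_image]
    exact image_mono hu

variable [AddCommGroup F] [Module ℝ F] {Λ : Finset E → Finset (F →ᵃ[ℝ] ℝ)}

theorem linearOn_pullback (hf : AffineOnFaces K f)
    (hinj : ∀ δ ∈ K, InjOn f (convexHull ℝ (δ : Set E))) : LinearOn (pullback K L f) f := by
  intro w hw hs
  obtain ⟨δ, hδ, hsub, -⟩ := (mem_pullback hinj).1 hs
  exact hf.apply_lc hδ hw hsub

theorem mapDomain_eq_of_lc_eq (hinj : ∀ δ ∈ K, InjOn f (convexHull ℝ (δ : Set E)))
    (hL : IsComplex L) {w w' : E →₀ ℝ} (hw : IsWeight w) (hw' : IsWeight w')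
    (hs : w.support ∈ pullback K L f) (hs' : w'.support ∈ pullback K L f)
    (he : lc f w = lc f w') : w.mapDomain f = w'.mapDomain f := by
  obtain ⟨-, -, -, hsL⟩ := (mem_pullback hinj).1 hs
  obtain ⟨-, -, -, hsL'⟩ := (mem_pullback hinj).1 hs'
  rw [← hw.support_mapDomain] at hsL
  rw [← hw'.support_mapDomain] at hsL'
  exact hL.uniq _ _ (hw.mapDomain f) (hw'.mapDomain f) hsL hsL'
    ((lc_mapDomain f id w).trans (he.trans (lc_mapDomain f id w').symm))

theorem support_subset_of_lc_mem (hf : AffineOnFaces K f)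
    (hinj : ∀ δ ∈ K, InjOn f (convexHull ℝ (δ : Set E))) (hΛ : IsCutOut K (imageFace f) Λ)
    (hcut : IsCut K Λ L) {w : E →₀ ℝ} (hw : IsWeight w) (hδ : δ ∈ K)
    (hsub : (w.support : Set E) ⊆ convexHull ℝ (δ : Set E)) (hL : w.support.image f ∈ L)
    {ε : Finset E} (hε : ε ∈ K) (hεδ : ε ⊆ δ) (hx : lc id w ∈ convexHull ℝ (ε : Set E)) :
    (w.support : Set E) ⊆ convexHull ℝ (ε : Set E) := by
  have hfx : lc id (w.mapDomain f) ∈ imageFace f ε := by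
    rw [lc_mapDomain, Function.id_comp, ← hf.apply_lc hδ hw hsub]
    exact mem_image_of_mem f hx
  rw [hcut.mem_iff hΛ hε (hw.mapDomain f) hL (hw.support_mapDomain f).le,
    hw.support_mapDomain] at hfx
  intro u hu
  obtain ⟨p, hp, hpu⟩ := hfx (f u) (Finset.mem_image_of_mem f hu)
  rwa [← hinj δ hδ (convexHull_mono (Finset.coe_subset.2 hεδ) hp) (hsub hu) hpu]

theorem isComplex_pullback (hK : IsComplex K) (hL : IsComplex L) (hf : AffineOnFaces K f)
    (hinj : ∀ δ ∈ K, InjOn f (convexHull ℝ (δ : Set E))) (hΛ : IsCutOut K (imageFace f) Λ)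
    (hcut : IsCut K Λ L) : IsComplex (pullback K L f) where
  down s hs t hts := by
    rw [mem_pullback hinj] at hs ⊢
    obtain ⟨δ, hδ, hsub, hsL⟩ := hs
    exact ⟨δ, hδ, (Finset.coe_subset.2 hts).trans hsub, hL.down _ hsL _ (Finset.image_mono _ hts)⟩
  uniq w w' hw hw' hs hs' he := by
    have hpush : w.mapDomain f = w'.mapDomain f := by
      refine mapDomain_eq_of_lc_eq hinj hL hw hw' hs hs' ?_
      rw [← linearOn_pullback hf hinj w hw hs, he, linearOn_pullback hf hinj w' hw' hs']
    obtain ⟨δ, hδ, hsub, hsL⟩ := (mem_pullback hinj).1 hs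
    obtain ⟨δ', hδ', hsub', hsL'⟩ := (mem_pullback hinj).1 hs'
    have hε : δ ∩ δ' ∈ K := hK.down δ hδ _ Finset.inter_subset_left
    have hx := hK.convexHull_inter hδ hδ' (hw.lc_id_mem (convex_convexHull ℝ _) hsub)
      (he ▸ hw'.lc_id_mem (convex_convexHull ℝ _) hsub')
    have recover {u : E →₀ ℝ} (hu : (u.support : Set E) ⊆ convexHull ℝ (δ ∩ δ' : Finset E)) :
        (u.mapDomain f).mapDomain (sheet f (δ ∩ δ')) = u := by
      rw [← Finsupp.mapDomain_comp]
      exact (Finsupp.mapDomain_congr fun v hv => sheet_apply (hinj _ hε) (hu hv)).trans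
        Finsupp.mapDomain_id
    rw [← recover (support_subset_of_lc_mem hf hinj hΛ hcut hw hδ hsub hsL hε
        Finset.inter_subset_left hx),
      ← recover (support_subset_of_lc_mem hf hinj hΛ hcut hw' hδ' hsub' hsL' hε
        Finset.inter_subset_right (he ▸ hx)), hpush]

theorem space_pullback (hK : IsComplex K) (hf : AffineOnFaces K f)
    (hinj : ∀ δ ∈ K, InjOn f (convexHull ℝ (δ : Set E))) (hΛ : IsCutOut K (imageFace f) Λ)
    (hcut : IsCut K Λ L) (hmaps : MapsTo f (space K) (space L)) :
    space (pullback K L f) = space K := by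
  ext x
  constructor
  · rintro ⟨w, hw, hs, rfl⟩
    obtain ⟨δ, hδ, hsub, -⟩ := (mem_pullback hinj).1 hs
    exact hK.mem_space_iff.2 ⟨δ, hδ, hw.lc_id_mem (convex_convexHull ℝ _) hsub⟩
  · intro hx
    obtain ⟨ω, hω, hωL, hωx⟩ := hmaps hx
    obtain ⟨δ, hδ, hxδ⟩ := hK.mem_space_iff.1 hx
    have hvert : (ω.support : Set F) ⊆ imageFace f δ :=
      (hcut.mem_iff hΛ hδ hω hωL subset_rfl).1 (hωx ▸ mem_image_of_mem f hxδ)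
    have hw := hω.mapDomain (sheet f δ)
    have hsupp := hω.support_mapDomain (sheet f δ)
    have hsub : ((ω.mapDomain (sheet f δ)).support : Set E) ⊆ convexHull ℝ (δ : Set E) := by
      rw [hsupp, Finset.coe_image]
      rintro _ ⟨v, hv, rfl⟩
      exact sheet_mem (hvert hv)
    refine ⟨_, hw, (mem_pullback hinj).2 ⟨δ, hδ, hsub, ?_⟩,
      hinj δ hδ (hw.lc_id_mem (convex_convexHull ℝ _) hsub) hxδ ?_⟩
    · rwa [hsupp, image_image_sheet hvert]
    · rw [hf.apply_lc hδ hw hsub, lc_mapDomain, ← hωx]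
      exact lc_congr fun v hv => apply_sheet (hvert hv)

end Pullback

section OrderedLift

variable {E F W α : Type*} [AddCommGroup E] [Module ℝ E] [AddCommGroup F] [Module ℝ F]
  [AddCommGroup W] [Module ℝ W] [LinearOrder α]

/-- A triangulation on which `f` is simplicial, with the vertices ordered by `o ∘ f` so that
two lifts of a simplex coincide in an initial face, and disjoint lifts of a simplex are separated
by `g`. -/
structure IsOrderedLift (K : Finset (Finset E)) (f : E → F) (g : E → W) (o : F → α) : Prop where
  complex : IsComplex K
  linear : LinearOn K f
  push : ∀ w w' : E →₀ ℝ, IsWeight w → IsWeight w' → w.support ∈ K → w'.support ∈ K →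
    lc f w = lc f w' → w.mapDomain f = w'.mapDomain f
  ordInj : ∀ s ∈ K, InjOn (fun u => o (f u)) (s : Set E)
  initial : ∀ s ∈ K, ∀ s' ∈ K, s.image f = s'.image f →
    ∀ u ∈ s, u ∈ s' → ∀ v ∈ s, v ∉ s' → o (f u) < o (f v)
  disj : ∀ s ∈ K, ∀ s' ∈ K, s.image f = s'.image f → Disjoint s s' →
    Disjoint (convexHull ℝ (g '' convexHull ℝ (s : Set E)))
      (convexHull ℝ (g '' convexHull ℝ (s' : Set E)))

end OrderedLift

section DepthOrder

variable {ι F : Type*} {I : Finset ι} {P : ι → Set F} {idx : F → ℕ} {x y : F}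

/-- The lexicographic order of points by decreasing depth, that is, by the number of members of
`P` containing them, with ties broken by the numbering `idx`. -/
noncomputable def depthOrder (I : Finset ι) (P : ι → Set F) (idx : F → ℕ) (y : F) : ℕᵒᵈ ×ₗ ℕ :=
  toLex (OrderDual.toDual (typeAt I P y).card, idx y)

theorem depthOrder_lt (h : typeAt I P y ⊂ typeAt I P x) :
    depthOrder I P idx x < depthOrder I P idx y :=
  Prod.Lex.toLex_lt_toLex.2 (Or.inl (OrderDual.toDual_lt_toDual.2 (Finset.card_lt_card h)))

theorem eq_of_depthOrder_eq (h : depthOrder I P idx x = depthOrder I P idx y) :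
    idx x = idx y :=
  congrArg (fun p => (ofLex p).2) h

end DepthOrder

section Existence

variable {E F W : Type*} [AddCommGroup E] [Module ℝ E] {K : Finset (Finset E)}
  {L : Finset (Finset F)} {f : E → F} {δ δ' s s' : Finset E}

theorem notMem_imageFace_inter (hinj : ∀ δ ∈ K, InjOn f (convexHull ℝ (δ : Set E))) (hδ : δ ∈ K)
    (hδ' : δ' ∈ K) {u v : E} (hu : u ∈ convexHull ℝ (δ : Set E))
    (hv : v ∈ convexHull ℝ (δ' : Set E)) (huv : f u = f v) (hne : u ≠ v) :
    f u ∉ imageFace f (δ ∩ δ') := by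
  rintro ⟨p, hp, hpu⟩
  have hpδ := convexHull_mono (Finset.coe_subset.2 Finset.inter_subset_left) hp
  have hpδ' := convexHull_mono (Finset.coe_subset.2 Finset.inter_subset_right) hp
  exact hne ((hinj δ hδ hpδ hu hpu).symm.trans (hinj δ' hδ' hpδ' hv (hpu.trans huv)))

theorem injOn_of_mem_pullback {idx : F → ℕ} (hinj : ∀ δ ∈ K, InjOn f (convexHull ℝ (δ : Set E)))
    (hidx : InjOn idx (L.biUnion id : Set F)) (hs : s ∈ pullback K L f) :
    InjOn (fun u => idx (f u)) (s : Set E) := by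
  obtain ⟨δ, hδ, hsδ, hsL⟩ := (mem_pullback hinj).1 hs
  exact hidx.comp ((hinj δ hδ).mono hsδ) fun u hu =>
    Finset.mem_biUnion.2 ⟨_, hsL, Finset.mem_image_of_mem f hu⟩

variable [AddCommGroup F] [Module ℝ F]

theorem typeAt_ssubset_of_pullback (hK : IsComplex K)
    (hinj : ∀ δ ∈ K, InjOn f (convexHull ℝ (δ : Set E)))
    (hchain : IsChainTyped K (imageFace f) L) (hs : s ∈ pullback K L f)
    (hs' : s' ∈ pullback K L f) (hss : s.image f = s'.image f) {u v : E} (hu : u ∈ s)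
    (hu' : u ∈ s') (hv : v ∈ s) (hv' : v ∉ s') :
    typeAt K (imageFace f) (f v) ⊂ typeAt K (imageFace f) (f u) := by
  obtain ⟨δ, hδ, hsδ, hsL⟩ := (mem_pullback hinj).1 hs
  obtain ⟨δ', hδ', hsδ', -⟩ := (mem_pullback hinj).1 hs'
  have hu_mem : δ ∩ δ' ∈ typeAt K (imageFace f) (f u) :=
    mem_typeAt.2 ⟨hK.down δ hδ _ Finset.inter_subset_left,
      mem_image_of_mem f (hK.convexHull_inter hδ hδ' (hsδ hu) (hsδ' hu'))⟩
  obtain ⟨q, hq, hqv⟩ := Finset.mem_image.1 (hss ▸ Finset.mem_image_of_mem f hv)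
  have hv_notMem : δ ∩ δ' ∉ typeAt K (imageFace f) (f v) := fun hmem =>
    notMem_imageFace_inter hinj hδ hδ' (hsδ hv) (hsδ' hq) hqv.symm
      (fun h => hv' (h ▸ hq)) (mem_typeAt.1 hmem).2
  have hvertex : ∀ x ∈ s, f x ∈ convexHull ℝ (s.image f : Set F) := fun x hx =>
    subset_convexHull ℝ _ (Finset.mem_image_of_mem f hx)
  exact ⟨(hchain _ hsL _ (hvertex u hu) _ (hvertex v hv)).resolve_left fun h =>
    hv_notMem (h hu_mem), fun h => hv_notMem (h hu_mem)⟩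

theorem AffineOnFaces.exists_isCutOut [FiniteDimensional ℝ F] (hf : AffineOnFaces K f)
    (hK : IsComplex K) (hinj : ∀ δ ∈ K, InjOn f (convexHull ℝ (δ : Set E))) :
    ∃ Λ, IsCutOut K (imageFace f) Λ := by
  have hface : ∀ δ ∈ K, ∃ Λ : Finset (F →ᵃ[ℝ] ℝ), imageFace f δ = {x | ∀ ℓ ∈ Λ, ℓ x ≤ 0} := by
    intro δ hδ
    rw [imageFace, hf.image_convexHull hδ (subset_convexHull ℝ _)]
    exact exists_convexHull_eq_halfspaces (hf.affineIndependent_image hK hδ (hinj δ hδ))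
  choose! Λ hΛ using hface
  exact ⟨Λ, hΛ⟩

theorem AffineOnFaces.image_subset_image_sheet (hf : AffineOnFaces K f)
    (hinj : InjOn f (convexHull ℝ (δ : Set E))) (hδ : δ ∈ K)
    (hs : (s : Set E) ⊆ convexHull ℝ (δ : Set E)) (g : E → W) {C : Set F}
    (hC : convexHull ℝ (s.image f : Set F) ⊆ C) :
    g '' convexHull ℝ (s : Set E) ⊆
      (fun y => g (sheet f δ y)) '' (convexHull ℝ (s.image f : Set F) ∩ C) := by
  rintro _ ⟨x, hx, rfl⟩
  have hfx := hf.image_convexHull hδ hs ▸ mem_image_of_mem f hx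
  refine ⟨f x, ⟨hfx, hC hfx⟩, ?_⟩
  simp only [sheet_apply hinj (convexHull_min hs (convex_convexHull ℝ _) hx)]

theorem AffineOnFaces.disjoint_convexHull_image [AddCommGroup W] [Module ℝ W] {g : E → W}
    (hf : AffineOnFaces K f) (hinj : ∀ δ ∈ K, InjOn f (convexHull ℝ (δ : Set E)))
    (hsep : ∀ n, IsSeparated K (imageFace f) (fun δ y => g (sheet f δ y)) (· ∩ ·) n L)
    (hs : s ∈ pullback K L f) (hs' : s' ∈ pullback K L f) (hss : s.image f = s'.image f)
    (hdis : Disjoint s s') :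
    Disjoint (convexHull ℝ (g '' convexHull ℝ (s : Set E)))
      (convexHull ℝ (g '' convexHull ℝ (s' : Set E))) := by
  obtain ⟨δ, hδ, hsδ, hsL⟩ := (mem_pullback hinj).1 hs
  obtain ⟨δ', hδ', hsδ', -⟩ := (mem_pullback hinj).1 hs'
  rcases s.eq_empty_or_nonempty with rfl | hne
  · simp
  have hC : convexHull ℝ (s.image f : Set F) ⊆ imageFace f δ ∩ imageFace f δ' := by
    refine subset_inter ?_ ?_
    · rw [← hf.image_convexHull hδ hsδ]
      exact image_mono (convexHull_min hsδ (convex_convexHull ℝ _))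
    · rw [hss, ← hf.image_convexHull hδ' hsδ']
      exact image_mono (convexHull_min hsδ' (convex_convexHull ℝ _))
  obtain ⟨u, hu, hmax⟩ :=
    s.exists_max_image (fun u => (typeAt K (imageFace f) (f u)).card) hne
  obtain ⟨u', hu', hfu⟩ := Finset.mem_image.1 (hss ▸ Finset.mem_image_of_mem f hu)
  have hvertex : f u ∈ convexHull ℝ (s.image f : Set F) :=
    subset_convexHull ℝ _ (Finset.mem_image_of_mem f hu)
  have hdeep : f u ∉ imageFace f (δ ∩ δ') :=
    notMem_imageFace_inter hinj hδ hδ' (hsδ hu) (hsδ' hu') hfu.symm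
      (Finset.disjoint_iff_ne.1 hdis u hu u' hu')
  refine (hsep _ _ hsL (fun v hv => ?_) δ hδ δ' hδ'
    ⟨f u, ⟨hvertex, hC hvertex⟩, rfl, hdeep⟩).mono
      (convexHull_mono (hf.image_subset_image_sheet (hinj δ hδ) hδ hsδ g hC))
      (convexHull_mono ?_)
  · obtain ⟨x, hx, rfl⟩ := Finset.mem_image.1 hv
    exact hmax x hx
  · rw [hss] at hC ⊢
    exact hf.image_subset_image_sheet (hinj δ' hδ') hδ' hsδ' g hC

end Existence

section ExistenceNormed

variable {E F W : Type*} [NormedAddCommGroup E] [NormedSpace ℝ E]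
  [NormedAddCommGroup F] [NormedSpace ℝ F] {K : Finset (Finset E)} {f : E → F} {δ : Finset E}

theorem AffineOnFaces.isCompact_imageFace [FiniteDimensional ℝ E] (hf : AffineOnFaces K f)
    (hδ : δ ∈ K) : IsCompact (imageFace f δ) := by
  obtain ⟨A, hA⟩ := hf δ hδ
  exact (δ.finite_toSet.isCompact_convexHull (𝕜 := ℝ)).image_of_continuousOn
    ((AffineMap.continuous_of_finiteDimensional A).continuousOn.congr hA)

variable [FiniteDimensional ℝ F]

theorem AffineOnFaces.continuousOn_comp_sheet [TopologicalSpace W] {g : E → W}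
    (hf : AffineOnFaces K f) (hK : IsComplex K) (hδ : δ ∈ K)
    (hinj : InjOn f (convexHull ℝ (δ : Set E))) (hg : ContinuousOn g (space K)) :
    ContinuousOn (fun y => g (sheet f δ y)) (imageFace f δ) := by
  obtain ⟨A, hA⟩ := hf.exists_affineMap_leftInvOn hK hδ hinj
  refine hg.comp ((AffineMap.continuous_of_finiteDimensional A).continuousOn.congr ?_)
    fun y hy => hK.mem_space_iff.2 ⟨δ, hδ, sheet_mem hy⟩
  rintro _ ⟨x, hx, rfl⟩
  rw [sheet_apply hinj hx, hA hx]

variable [FiniteDimensional ℝ E] [NormedAddCommGroup W] [NormedSpace ℝ W]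

theorem exists_isOrderedLift {L : Finset (Finset F)} {g : E → W} (hK : IsComplex K)
    (hL : IsComplex L) (hf : AffineOnFaces K f)
    (hinj : ∀ δ ∈ K, InjOn f (convexHull ℝ (δ : Set E))) (hmaps : MapsTo f (space K) (space L))
    (hg : ContinuousOn g (space K))
    (hfib : ∀ x ∈ space K, ∀ y ∈ space K, f x = f y → g x = g y → x = y) :
    ∃ (K' : Finset (Finset E)) (o : F → ℕᵒᵈ ×ₗ ℕ), IsOrderedLift K' f g o ∧ space K' = space K ∧
      ∀ u ∈ K', ∃ δ ∈ K, (u : Set E) ⊆ convexHull ℝ (δ : Set E) := by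
  obtain ⟨Λ, hΛ⟩ := hf.exists_isCutOut hK hinj
  have hspace : ∀ δ ∈ K, ∀ y ∈ imageFace f δ, sheet f δ y ∈ space K := fun δ hδ y hy =>
    hK.mem_space_iff.2 ⟨δ, hδ, sheet_mem hy⟩
  obtain ⟨L', hL', hspL, hcut, hchain, hsep⟩ := exists_isSeparated hΛ
    (fun δ hδ => hf.isCompact_imageFace hδ)
    (fun δ hδ => hf.continuousOn_comp_sheet hK hδ (hinj δ hδ) hg) (c := (· ∩ ·))
    (fun δ hδ δ' _ => hK.down δ hδ _ Finset.inter_subset_left)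
    (fun δ hδ δ' hδ' y hy hy' heq => by
      have hxy := hfib _ (hspace δ hδ y hy) _ (hspace δ' hδ' y hy')
        ((apply_sheet hy).trans (apply_sheet hy').symm) heq
      exact ⟨_, hK.convexHull_inter hδ hδ' (sheet_mem hy) (hxy ▸ sheet_mem hy'), apply_sheet hy⟩)
    hL
  obtain ⟨idx, hidx⟩ := countable_iff_exists_injOn.1 (L'.biUnion id).finite_toSet.countable
  refine ⟨pullback K L' f, depthOrder K (imageFace f) idx,
    { complex := isComplex_pullback hK hL' hf hinj hΛ hcut
      linear := linearOn_pullback hf hinj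
      push := fun w w' hw hw' hs hs' => mapDomain_eq_of_lc_eq hinj hL' hw hw' hs hs'
      ordInj := fun s hs u hu v hv h =>
        injOn_of_mem_pullback hinj hidx hs hu hv (eq_of_depthOrder_eq h)
      initial := fun s hs s' hs' hss u hu hu' v hv hv' =>
        depthOrder_lt (typeAt_ssubset_of_pullback hK hinj hchain hs hs' hss hu hu' hv hv')
      disj := fun s hs s' hs' => hf.disjoint_convexHull_image hinj hsep hs hs' },
    space_pullback hK hf hinj hΛ hcut (hspL ▸ hmaps), fun u hu => ?_⟩
  obtain ⟨δ, hδ, hsub, -⟩ := (mem_pullback hinj).1 hu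
  exact ⟨δ, hδ, hsub⟩

end ExistenceNormed

section Extraction

variable {E α : Type*} [LinearOrder α] {κ : E → α} {t : ℝ} {w : E →₀ ℝ} {u v : E}

/-- The mass of `w` on the vertices preceding `c` in the order given by `κ`. -/
noncomputable def massBelow (κ : E → α) (w : E →₀ ℝ) (c : α) : ℝ :=
  lc (fun u => if κ u < c then (1 : ℝ) else 0) w

/-- The part of `w` consisting of its first `t` units of mass, in the order given by `κ`. -/
noncomputable def extract (κ : E → α) (t : ℝ) (w : E →₀ ℝ) : E →₀ ℝ :=
  Finsupp.onFinset w.support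
    (fun u => min t (massBelow κ w (κ u) + w u) - min t (massBelow κ w (κ u)))
    (fun u hu => Finsupp.mem_support_iff.2 fun h => hu (by rw [h, add_zero, sub_self]))

/-- What remains of `w` after the extraction of its first `t` units of mass, normalized. -/
noncomputable def remainder (κ : E → α) (t : ℝ) (w : E →₀ ℝ) : E →₀ ℝ :=
  (1 - t)⁻¹ • (w - extract κ t w)

theorem massBelow_eq_sum (κ : E → α) (w : E →₀ ℝ) (c : α) :
    massBelow κ w c = ∑ u ∈ w.support with κ u < c, w u := by
  rw [massBelow, lc_eq_sum subset_rfl, Finset.sum_filter]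
  exact Finset.sum_congr rfl fun u _ => by simp

theorem extract_apply (κ : E → α) (t : ℝ) (w : E →₀ ℝ) (u : E) :
    extract κ t w u = min t (massBelow κ w (κ u) + w u) - min t (massBelow κ w (κ u)) := rfl

theorem support_extract (κ : E → α) (t : ℝ) (w : E →₀ ℝ) :
    (extract κ t w).support ⊆ w.support := Finsupp.support_onFinset_subset

theorem extract_eq_zero_of_notMem (hu : u ∉ w.support) : extract κ t w u = 0 :=
  Finsupp.notMem_support_iff.1 fun h => hu (support_extract κ t w h)

theorem support_remainder (κ : E → α) (t : ℝ) (w : E →₀ ℝ) :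
    (remainder κ t w).support ⊆ w.support :=
  Finsupp.support_smul.trans (Finsupp.support_sub.trans
    (Finset.union_subset subset_rfl (support_extract κ t w)))

theorem extract_add_remainder (κ : E → α) (ht : t < 1) (w : E →₀ ℝ) :
    extract κ t w + (1 - t) • remainder κ t w = w := by
  rw [remainder, smul_inv_smul₀ (sub_pos.2 ht).ne', add_sub_cancel]

namespace IsWeight

theorem massBelow_nonneg (hw : IsWeight w) (c : α) : 0 ≤ massBelow κ w c := by
  rw [massBelow_eq_sum]
  exact Finset.sum_nonneg fun u _ => hw.nonneg u

theorem massBelow_add_le (hw : IsWeight w) {s : Finset E}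
    (hs : ∀ v ∈ w.support, κ v ≤ κ u → v ∈ s) :
    massBelow κ w (κ u) + w u ≤ ∑ v ∈ s, w v := by
  have hle : ∀ r ⊆ s, ∑ v ∈ r, w v ≤ ∑ v ∈ s, w v := fun r hr =>
    Finset.sum_le_sum_of_subset_of_nonneg hr fun v _ _ => hw.nonneg v
  have hbelow : w.support.filter (κ · < κ u) ⊆ s := fun v hv =>
    hs v (Finset.mem_filter.1 hv).1 (Finset.mem_filter.1 hv).2.le
  rw [massBelow_eq_sum]
  by_cases hu : u ∈ w.support
  · rw [add_comm, ← Finset.sum_insert (by simp)]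
    exact hle _ (Finset.insert_subset (hs u hu le_rfl) hbelow)
  · rw [Finsupp.notMem_support_iff.1 hu, add_zero]
    exact hle _ hbelow

theorem extract_nonneg (hw : IsWeight w) (u : E) : 0 ≤ extract κ t w u :=
  sub_nonneg.2 (min_le_min_left _ (le_add_of_nonneg_right (hw.nonneg u)))

theorem extract_le (hw : IsWeight w) (u : E) : extract κ t w u ≤ w u := by
  rw [extract_apply, sub_le_iff_le_add, ← min_add_add_left]
  exact min_le_min (le_add_of_nonneg_left (hw.nonneg u)) (add_comm _ _).le

theorem extract_zero (hw : IsWeight w) : extract κ 0 w = 0 := by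
  ext u
  have hbelow := hw.massBelow_nonneg (κ := κ) (κ u)
  rw [extract_apply, min_eq_left hbelow, min_eq_left (add_nonneg hbelow (hw.nonneg u)), sub_self,
    Finsupp.zero_apply]

theorem extract_of_le (hw : IsWeight w) (h : massBelow κ w (κ u) + w u ≤ t) :
    extract κ t w u = w u := by
  rw [extract_apply, min_eq_right h,
    min_eq_right ((le_add_of_nonneg_right (hw.nonneg u)).trans h), add_sub_cancel_left]

theorem extract_one (hw : IsWeight w) : extract κ 1 w = w :=
  Finsupp.ext fun _ => hw.extract_of_le
    ((hw.massBelow_add_le fun _ hv _ => hv).trans (hw.sum_eq_one subset_rfl).le)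

theorem extract_eq_zero_of_lt (hw : IsWeight w) (hlt : extract κ t w u < w u)
    (huv : κ u < κ v) : extract κ t w v = 0 := by
  have ht : t < massBelow κ w (κ u) + w u :=
    lt_of_not_ge fun h => hlt.ne (hw.extract_of_le h)
  have hle : massBelow κ w (κ u) + w u ≤ massBelow κ w (κ v) := by
    rw [massBelow_eq_sum κ w (κ v)]
    exact hw.massBelow_add_le fun x hx hxu => Finset.mem_filter.2 ⟨hx, hxu.trans_lt huv⟩
  have htv := ht.le.trans hle
  rw [extract_apply, min_eq_left htv,
    min_eq_left (htv.trans (le_add_of_nonneg_right (hw.nonneg v))), sub_self]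

end IsWeight

theorem sum_min_sub_min (w : E → ℝ) (t : ℝ) (s : Finset E) (hκ : InjOn κ (s : Set E)) :
    ∑ u ∈ s, (min t (∑ v ∈ s with κ v < κ u, w v + w u) - min t (∑ v ∈ s with κ v < κ u, w v)) =
      min t (∑ u ∈ s, w u) - min t 0 := by
  induction s using Finset.induction_on_max_value κ with
  | empty => simp
  | insert a s has hmax ih =>
    have hlt : ∀ x ∈ s, κ x < κ a := fun x hx => (hmax x hx).lt_of_ne fun h =>
      has (hκ (by simp [hx]) (by simp) h ▸ hx)
    have hfilter_max : (insert a s).filter (κ · < κ a) = s := by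
      rw [Finset.filter_insert, if_neg (lt_irrefl _), Finset.filter_true_of_mem hlt]
    have hfilter : ∀ u ∈ s, (insert a s).filter (κ · < κ u) = s.filter (κ · < κ u) :=
      fun u hu => by rw [Finset.filter_insert, if_neg (hlt u hu).not_gt]
    have hsum := ih (hκ.mono (by simp))
    rw [Finset.sum_congr rfl fun u hu => by rw [← hfilter u hu]] at hsum
    rw [Finset.sum_insert has, hfilter_max, Finset.sum_insert has, hsum, add_comm (w a)]
    ring

namespace IsWeight

theorem sum_extract (hw : IsWeight w) (ht : t ∈ Icc (0 : ℝ) 1)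
    (hκ : InjOn κ (w.support : Set E)) : ∑ u ∈ w.support, extract κ t w u = t := by
  simp only [extract_apply, massBelow_eq_sum]
  rw [sum_min_sub_min w t _ hκ, hw.sum_eq_one subset_rfl, min_eq_left ht.2, min_eq_right ht.1,
    sub_zero]

theorem remainder (hw : IsWeight w) (ht : t ∈ Ico (0 : ℝ) 1)
    (hκ : InjOn κ (w.support : Set E)) : IsWeight (remainder κ t w) where
  nonneg v := mul_nonneg (inv_nonneg.2 (sub_nonneg.2 ht.2.le)) (sub_nonneg.2 (hw.extract_le v))
  mass := by
    rw [PLLift.remainder, map_smul, map_sub, hw.mass, lc_one_eq_sum (support_extract κ t w),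
      hw.sum_extract (Ico_subset_Icc_self ht) hκ, smul_eq_mul, inv_mul_cancel₀ (sub_pos.2 ht.2).ne']

end IsWeight

theorem extract_mapDomain {F : Type*} {f : E → F} (κ : F → α) (t : ℝ)
    (hf : InjOn f (w.support : Set E)) (hu : u ∈ w.support) :
    extract κ t (w.mapDomain f) (f u) = extract (fun v => κ (f v)) t w u := by
  have hbelow : ∀ c, massBelow κ (w.mapDomain f) c = massBelow (fun v => κ (f v)) w c :=
    fun c => lc_mapDomain f _ w
  rw [extract_apply, extract_apply, hbelow, Finsupp.mapDomain_apply' _ _ subset_rfl hf hu]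

end Extraction

section Straightening

variable {E W α : Type*} [AddCommGroup E] [Module ℝ E] [AddCommGroup W] [Module ℝ W]
  [LinearOrder α] {κ : E → α} {g : E → W} {t : ℝ} {w : E →₀ ℝ}

/-- The value at `lc id w` of the straightening of `g` at time `t`: the first `t` units of the mass
of `w`, in the order given by `κ`, are mapped linearly, the rest by `g`. -/
noncomputable def straightenWeight (κ : E → α) (g : E → W) (t : ℝ) (w : E →₀ ℝ) : W :=
  lc g (extract κ t w) + (1 - t) • g (lc id (remainder κ t w))

namespace IsWeight

theorem straightenWeight_zero (hw : IsWeight w) (κ : E → α) (g : E → W) :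
    straightenWeight κ g 0 w = g (lc id w) := by
  simp [straightenWeight, PLLift.remainder, hw.extract_zero]

theorem straightenWeight_one (hw : IsWeight w) (κ : E → α) (g : E → W) :
    straightenWeight κ g 1 w = lc g w := by
  simp [straightenWeight, hw.extract_one]

theorem straightenWeight_of_affine (hw : IsWeight w) (ht : t ∈ Icc (0 : ℝ) 1)
    (hκ : InjOn κ (w.support : Set E)) {A : E →ᵃ[ℝ] W}
    (hA : EqOn g A (convexHull ℝ (w.support : Set E))) :
    straightenWeight κ g t w = g (lc id w) := by
  have hlin {u : E →₀ ℝ} (hu : IsWeight u) (hus : u.support ⊆ w.support) :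
      g (lc id u) = lc g u := by
    rw [hA (mem_convexHull_iff_weight.2 ⟨u, hu, hus, rfl⟩), affineMap_lc A id hu.mass]
    exact lc_congr fun v hv => (hA (subset_convexHull ℝ _ (hus hv))).symm
  rcases ht.2.eq_or_lt with rfl | ht1
  · rw [hw.straightenWeight_one, hlin hw subset_rfl]
  · rw [straightenWeight, hlin (hw.remainder ⟨ht.1, ht1⟩ hκ) (support_remainder κ t w), ← map_smul,
      ← map_add, extract_add_remainder κ ht1, hlin hw subset_rfl]

end IsWeight

open Pointwise in
theorem sum_smul_mem_smul {ι : Type*} {C : Set W} (hC : Convex ℝ C) (hne : C.Nonempty)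
    {s : Finset ι} {a : ι → ℝ} {z : ι → W} (ha : ∀ u ∈ s, 0 ≤ a u) (hz : ∀ u ∈ s, z u ∈ C) :
    ∑ u ∈ s, a u • z u ∈ (∑ u ∈ s, a u) • C := by
  induction s using Finset.induction_on with
  | empty => simp [zero_smul_set hne]
  | insert u s hu ih =>
    rw [Finset.forall_mem_insert] at ha hz
    rw [Finset.sum_insert hu, Finset.sum_insert hu,
      hC.add_smul ha.1 (Finset.sum_nonneg ha.2)]
    exact add_mem_add (smul_mem_smul_set hz.1) (ih ha.2 hz.2)

namespace IsWeight

theorem lc_id_remainder_mem (hw : IsWeight w) (ht : t ∈ Ico (0 : ℝ) 1)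
    (hκ : InjOn κ (w.support : Set E)) {s : Finset E}
    (hext : ∀ u ∈ w.support ∩ s, extract κ t w u = w u) :
    lc id (PLLift.remainder κ t w) ∈ convexHull ℝ ((w.support \ s : Finset E) : Set E) := by
  refine mem_convexHull_iff_weight.2 ⟨_, hw.remainder ht hκ, fun v hv => ?_, rfl⟩
  have hvw := support_remainder κ t w hv
  refine Finset.mem_sdiff.2 ⟨hvw, fun hvs => Finsupp.mem_support_iff.1 hv ?_⟩
  simp [PLLift.remainder, hext v (Finset.mem_inter.2 ⟨hvw, hvs⟩)]

open Pointwise in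
theorem exists_straightenWeight_eq (hw : IsWeight w) (ht : t ∈ Icc (0 : ℝ) 1)
    (hκ : InjOn κ (w.support : Set E)) (g : E → W) {s : Finset E}
    (hext : ∀ u ∈ w.support ∩ s, extract κ t w u = w u) (hne : (w.support \ s).Nonempty) :
    ∃ p ∈ convexHull ℝ (g '' convexHull ℝ ((w.support \ s : Finset E) : Set E)),
      straightenWeight κ g t w =
        ∑ u ∈ w.support ∩ s, w u • g u + (∑ u ∈ w.support \ s, w u) • p := by
  set C := convexHull ℝ (g '' convexHull ℝ ((w.support \ s : Finset E) : Set E))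
  have hC : Convex ℝ C := convex_convexHull ℝ _
  have hgC : ∀ u ∈ w.support \ s, g u ∈ C := fun u hu =>
    subset_convexHull ℝ _ (mem_image_of_mem g (subset_convexHull ℝ _ hu))
  have hCne : C.Nonempty := ⟨_, hgC _ hne.choose_spec⟩
  have hrem : (1 - t) • g (lc id (PLLift.remainder κ t w)) ∈ (1 - t) • C := by
    rcases ht.2.eq_or_lt with rfl | ht1
    · simp [zero_smul_set hCne]
    · exact smul_mem_smul_set (subset_convexHull ℝ _
        (mem_image_of_mem g (hw.lc_id_remainder_mem ⟨ht.1, ht1⟩ hκ hext)))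
  have hmass : ∑ u ∈ w.support \ s, extract κ t w u + (1 - t) = ∑ u ∈ w.support \ s, w u := by
    have hsum := hw.sum_extract ht hκ
    have hone := hw.sum_eq_one subset_rfl
    rw [← Finset.sum_inter_add_sum_sdiff w.support s, Finset.sum_congr rfl hext] at hsum
    rw [← Finset.sum_inter_add_sum_sdiff w.support s] at hone
    linarith
  have hext_nonneg : ∀ u ∈ w.support \ s, 0 ≤ extract κ t w u := fun u _ => hw.extract_nonneg u
  have hmem := add_mem_add (sum_smul_mem_smul hC hCne hext_nonneg hgC) hrem
  rw [← hC.add_smul (Finset.sum_nonneg hext_nonneg) (sub_nonneg.2 ht.2),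
    hmass] at hmem
  obtain ⟨p, hp, hpeq⟩ := hmem
  refine ⟨p, hp, ?_⟩
  simp only at hpeq
  rw [hpeq, straightenWeight, lc_eq_sum (support_extract κ t w),
    ← Finset.sum_inter_add_sum_sdiff w.support s, add_assoc,
    Finset.sum_congr rfl fun u hu => by rw [hext u hu]]

end IsWeight

end Straightening

section Injectivity

variable {E F W α : Type*} {f : E → F} {w w' : E →₀ ℝ}

theorem IsWeight.image_support_eq (hw : IsWeight w) (hw' : IsWeight w')
    (hm : w.mapDomain f = w'.mapDomain f) : w.support.image f = w'.support.image f := by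
  rw [← hw.support_mapDomain, ← hw'.support_mapDomain, hm]

theorem image_sdiff_eq_image_sdiff {s s' : Finset E} (hs : InjOn f (s : Set E))
    (hs' : InjOn f (s' : Set E)) (hss : s.image f = s'.image f) :
    (s \ s').image f = (s' \ s).image f := by
  rw [← Finset.sdiff_inter_self_left s s', ← Finset.sdiff_inter_self_left s' s,
    Finset.image_sdiff_of_injOn hs Finset.inter_subset_left,
    Finset.image_sdiff_of_injOn hs' Finset.inter_subset_left, hss, Finset.inter_comm]

variable [AddCommGroup E] [Module ℝ E] [AddCommGroup F] [Module ℝ F] [AddCommGroup W] [Module ℝ W]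
  [LinearOrder α] {K : Finset (Finset E)} {g : E → W} {o : F → α} {t : ℝ}

namespace IsOrderedLift

theorem injOn (hK : IsOrderedLift K f g o) {s : Finset E} (hs : s ∈ K) : InjOn f (s : Set E) :=
  fun _ hu _ hv h => hK.ordInj s hs hu hv (congrArg o h)

theorem weight_eq (hK : IsOrderedLift K f g o) (hs : w.support ∈ K) (hs' : w'.support ∈ K)
    (hm : w.mapDomain f = w'.mapDomain f) {u : E} (hu : u ∈ w.support) (hu' : u ∈ w'.support) :
    w u = w' u := by
  rw [← Finsupp.mapDomain_apply' _ w subset_rfl (hK.injOn hs) hu, hm,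
    Finsupp.mapDomain_apply' _ w' subset_rfl (hK.injOn hs') hu']

theorem extract_eq (hK : IsOrderedLift K f g o) (hs : w.support ∈ K) (hs' : w'.support ∈ K)
    (hm : w.mapDomain f = w'.mapDomain f) {u : E} (hu : u ∈ w.support) (hu' : u ∈ w'.support) :
    extract (fun v => o (f v)) t w u = extract (fun v => o (f v)) t w' u := by
  rw [← extract_mapDomain o t (hK.injOn hs) hu, hm, extract_mapDomain o t (hK.injOn hs') hu']

theorem extract_eq_zero_of_notMem (hK : IsOrderedLift K f g o) (hw : IsWeight w)
    (hs : w.support ∈ K) (hs' : w'.support ∈ K) (hss : w.support.image f = w'.support.image f)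
    {u v : E} (hu : u ∈ w.support) (hu' : u ∈ w'.support)
    (hlt : extract (fun v => o (f v)) t w u < w u) (hv : v ∉ w'.support) :
    extract (fun v => o (f v)) t w v = 0 := by
  by_cases hvw : v ∈ w.support
  · exact hw.extract_eq_zero_of_lt hlt (hK.initial _ hs _ hs' hss u hu hu' v hvw hv)
  · exact PLLift.extract_eq_zero_of_notMem hvw

theorem extract_congr (hK : IsOrderedLift K f g o) (hw : IsWeight w) (hw' : IsWeight w')
    (hs : w.support ∈ K) (hs' : w'.support ∈ K) (hm : w.mapDomain f = w'.mapDomain f) {u : E}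
    (hu : u ∈ w.support) (hu' : u ∈ w'.support)
    (hlt : extract (fun v => o (f v)) t w u < w u) :
    extract (fun v => o (f v)) t w = extract (fun v => o (f v)) t w' := by
  have hss := hw.image_support_eq hw' hm
  have hlt' : extract (fun v => o (f v)) t w' u < w' u := by
    rwa [← hK.weight_eq hs hs' hm hu hu', ← hK.extract_eq hs hs' hm hu hu']
  ext v
  by_cases hv : v ∈ w.support
  · by_cases hv' : v ∈ w'.support
    · exact hK.extract_eq hs hs' hm hv hv'
    · rw [hK.extract_eq_zero_of_notMem hw hs hs' hss hu hu' hlt hv',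
        PLLift.extract_eq_zero_of_notMem hv']
  · rw [hK.extract_eq_zero_of_notMem hw' hs' hs hss.symm hu' hu hlt' hv,
      PLLift.extract_eq_zero_of_notMem hv]

theorem lc_id_eq_of_extract_eq (hK : IsOrderedLift K f g o)
    (hfib : ∀ x ∈ space K, ∀ y ∈ space K, f x = f y → g x = g y → x = y) (hw : IsWeight w)
    (hw' : IsWeight w') (hs : w.support ∈ K) (hs' : w'.support ∈ K)
    (hm : w.mapDomain f = w'.mapDomain f) (ht : t ∈ Ico (0 : ℝ) 1)
    (hext : extract (fun v => o (f v)) t w = extract (fun v => o (f v)) t w')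
    (heq : straightenWeight (fun v => o (f v)) g t w = straightenWeight (fun v => o (f v)) g t w') :
    lc id w = lc id w' := by
  set κ := fun v => o (f v)
  have hρ := hw.remainder ht (hK.ordInj _ hs)
  have hρ' := hw'.remainder ht (hK.ordInj _ hs')
  have hρK := hK.complex.down _ hs _ (support_remainder κ t w)
  have hρK' := hK.complex.down _ hs' _ (support_remainder κ t w')
  have hfw : lc f w = lc f w' := by
    simpa only [lc_mapDomain, Function.id_comp] using congrArg (lc id) hm
  have hg : g (lc id (remainder κ t w)) = g (lc id (remainder κ t w')) := by
    rw [straightenWeight, straightenWeight, hext] at heq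
    exact smul_right_injective W (sub_pos.2 ht.2).ne' (add_left_cancel heq)
  have hf : f (lc id (remainder κ t w)) = f (lc id (remainder κ t w')) := by
    rw [hK.linear _ hρ hρK, hK.linear _ hρ' hρK', remainder, remainder, map_smul, map_smul,
      map_sub, map_sub, hext, hfw]
  rw [← extract_add_remainder κ ht.2 w, ← extract_add_remainder κ ht.2 w', map_add, map_add,
    map_smul, map_smul, hext, hfib _ ⟨_, hρ, hρK, rfl⟩ _ ⟨_, hρ', hρK', rfl⟩ hf hg]

theorem eq_of_extract_of_inter (hK : IsOrderedLift K f g o) (hw : IsWeight w) (hw' : IsWeight w')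
    (hs : w.support ∈ K) (hs' : w'.support ∈ K) (hm : w.mapDomain f = w'.mapDomain f)
    (ht : t ∈ Icc (0 : ℝ) 1)
    (hext : ∀ u ∈ w.support ∩ w'.support, extract (fun v => o (f v)) t w u = w u)
    (heq : straightenWeight (fun v => o (f v)) g t w = straightenWeight (fun v => o (f v)) g t w') :
    w = w' := by
  have hinter : ∀ u ∈ w.support ∩ w'.support, w u = w' u := fun u hu =>
    hK.weight_eq hs hs' hm (Finset.mem_inter.1 hu).1 (Finset.mem_inter.1 hu).2
  have hsdiff := image_sdiff_eq_image_sdiff (hK.injOn hs) (hK.injOn hs')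
    (hw.image_support_eq hw' hm)
  rcases (w.support \ w'.support).eq_empty_or_nonempty with hempty | hne
  · have hempty' : w'.support \ w.support = ∅ := by
      rwa [hempty, Finset.image_empty, eq_comm, Finset.image_eq_empty] at hsdiff
    have hsupp : w.support = w'.support :=
      (Finset.sdiff_eq_empty_iff_subset.1 hempty).antisymm
        (Finset.sdiff_eq_empty_iff_subset.1 hempty')
    exact Finsupp.ext_iff'.2 ⟨hsupp, fun u hu =>
      hinter u (Finset.mem_inter.2 ⟨hu, hsupp ▸ hu⟩)⟩
  · have hne' : (w'.support \ w.support).Nonempty := by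
      rw [← Finset.image_nonempty (f := f), ← hsdiff]
      exact hne.image f
    have hext' : ∀ u ∈ w'.support ∩ w.support, extract (fun v => o (f v)) t w' u = w' u := by
      intro u hu
      rw [Finset.inter_comm] at hu
      obtain ⟨huw, huw'⟩ := Finset.mem_inter.1 hu
      rw [← hK.extract_eq hs hs' hm huw huw', hext u hu, hinter u hu]
    obtain ⟨p, hp, hwp⟩ := hw.exists_straightenWeight_eq ht (hK.ordInj _ hs) g hext hne
    obtain ⟨p', hp', hwp'⟩ := hw'.exists_straightenWeight_eq ht (hK.ordInj _ hs') g hext' hne'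
    have hpos : 0 < ∑ u ∈ w.support \ w'.support, w u :=
      Finset.sum_pos (fun u hu => hw.pos (Finset.mem_sdiff.1 hu).1) hne
    have hmass := hw.sum_sdiff_eq_sum_sdiff hw' hinter
    have hpp : p = p' := by
      rw [hwp, hwp', ← hmass, Finset.inter_comm w'.support,
        Finset.sum_congr rfl fun u hu => by rw [hinter u hu]] at heq
      exact smul_right_injective W hpos.ne' (add_left_cancel heq)
    have hdisj := hK.disj _ (hK.complex.down _ hs _ Finset.sdiff_subset) _
      (hK.complex.down _ hs' _ Finset.sdiff_subset) hsdiff disjoint_sdiff_sdiff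
    exact absurd (hpp ▸ hp') (disjoint_left.1 hdisj hp)

theorem lc_id_eq_of_straightenWeight_eq (hK : IsOrderedLift K f g o)
    (hfib : ∀ x ∈ space K, ∀ y ∈ space K, f x = f y → g x = g y → x = y) (hw : IsWeight w)
    (hw' : IsWeight w') (hs : w.support ∈ K) (hs' : w'.support ∈ K)
    (hm : w.mapDomain f = w'.mapDomain f) (ht : t ∈ Icc (0 : ℝ) 1)
    (heq : straightenWeight (fun v => o (f v)) g t w = straightenWeight (fun v => o (f v)) g t w') :
    lc id w = lc id w' := by
  by_cases hpartial :
      ∃ u ∈ w.support ∩ w'.support, extract (fun v => o (f v)) t w u < w u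
  · obtain ⟨u, hu, hlt⟩ := hpartial
    have ht1 : t ≠ 1 := by
      rintro rfl
      exact hlt.ne (by rw [hw.extract_one])
    have hext := hK.extract_congr hw hw' hs hs' hm (Finset.mem_inter.1 hu).1
      (Finset.mem_inter.1 hu).2 hlt
    exact hK.lc_id_eq_of_extract_eq hfib hw hw' hs hs' hm ⟨ht.1, ht.2.lt_of_ne ht1⟩ hext heq
  · push Not at hpartial
    rw [hK.eq_of_extract_of_inter hw hw' hs hs' hm ht
      (fun u hu => (hw.extract_le u).antisymm (hpartial u hu)) heq]

end IsOrderedLift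

end Injectivity

section Homotopy

variable {E W α : Type*} [AddCommGroup E] [Module ℝ E] [AddCommGroup W] [Module ℝ W]
  [LinearOrder α] {K : Finset (Finset E)} {κ : E → α} {g : E → W} {t : ℝ} {x : E}

/-- The barycentric weights of a point of a complex. -/
noncomputable def weights (K : Finset (Finset E)) : E → E →₀ ℝ :=
  Function.invFunOn (lc id) {w | IsWeight w ∧ w.support ∈ K}

theorem exists_weight_of_mem_space (hx : x ∈ space K) :
    ∃ w ∈ {w : E →₀ ℝ | IsWeight w ∧ w.support ∈ K}, lc id w = x := by
  obtain ⟨w, hw, hs, rfl⟩ := hx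
  exact ⟨w, ⟨hw, hs⟩, rfl⟩

theorem isWeight_weights (hx : x ∈ space K) : IsWeight (weights K x) :=
  (Function.invFunOn_mem (exists_weight_of_mem_space hx)).1

theorem support_weights_mem (hx : x ∈ space K) : (weights K x).support ∈ K :=
  (Function.invFunOn_mem (exists_weight_of_mem_space hx)).2

theorem lc_id_weights (hx : x ∈ space K) : lc id (weights K x) = x :=
  Function.invFunOn_eq (exists_weight_of_mem_space hx)

namespace IsComplex

theorem weights_lc (hK : IsComplex K) {w : E →₀ ℝ} (hw : IsWeight w) (hs : w.support ∈ K) :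
    weights K (lc id w) = w :=
  have hx : lc id w ∈ space K := ⟨w, hw, hs, rfl⟩
  hK.uniq _ _ (isWeight_weights hx) hw (support_weights_mem hx) hs (lc_id_weights hx)

theorem linearOn_lc_weights (hK : IsComplex K) (g : E → W) :
    LinearOn K (fun x => lc g (weights K x)) := by
  intro w hw hs
  simp only [hK.weights_lc hw hs]
  refine lc_congr fun v hv => ?_
  have hsingle : (Finsupp.single v (1 : ℝ)).support ∈ K := hK.down _ hs _
    (Finsupp.support_single_subset.trans (Finset.singleton_subset_iff.2 hv))
  have hv := hK.weights_lc (isWeight_single v) hsingle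
  rw [Finsupp.linearCombination_single, one_smul, id] at hv
  simp only [hv, Finsupp.linearCombination_single, one_smul]

end IsComplex

/-- The straightening of `g` over the complex `K`: a homotopy from `g` to a map linear on the faces
of `K`. -/
noncomputable def straighten (K : Finset (Finset E)) (κ : E → α) (g : E → W) (t : ℝ) (x : E) : W :=
  straightenWeight κ g t (weights K x)

theorem straighten_zero (κ : E → α) (g : E → W) (hx : x ∈ space K) :
    straighten K κ g 0 x = g x := by
  rw [straighten, (isWeight_weights hx).straightenWeight_zero, lc_id_weights hx]

theorem IsComplex.linearOn_straighten_one (hK : IsComplex K) (κ : E → α) (g : E → W) :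
    LinearOn K (straighten K κ g 1) :=
  (hK.linearOn_lc_weights g).congr hK fun _ hx => (isWeight_weights hx).straightenWeight_one κ g

namespace IsOrderedLift

variable {F : Type*} [AddCommGroup F] [Module ℝ F] {f : E → F} {o : F → α}

theorem straighten_of_affine (hK : IsOrderedLift K f g o) (hx : x ∈ space K)
    (ht : t ∈ Icc (0 : ℝ) 1) {A : E →ᵃ[ℝ] W}
    (hA : EqOn g A (convexHull ℝ ((weights K x).support : Set E))) :
    straighten K (fun v => o (f v)) g t x = g x := by
  rw [straighten, (isWeight_weights hx).straightenWeight_of_affine ht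
    (hK.ordInj _ (support_weights_mem hx)) hA, lc_id_weights hx]

theorem straighten_injective (hK : IsOrderedLift K f g o)
    (hfib : ∀ x ∈ space K, ∀ y ∈ space K, f x = f y → g x = g y → x = y)
    (ht : t ∈ Icc (0 : ℝ) 1) {x' : E} (hx : x ∈ space K) (hx' : x' ∈ space K) (hff : f x = f x')
    (heq : straighten K (fun v => o (f v)) g t x = straighten K (fun v => o (f v)) g t x') :
    x = x' := by
  have hw := isWeight_weights hx
  have hw' := isWeight_weights hx'
  have hs := support_weights_mem hx
  have hs' := support_weights_mem hx'
  rw [← lc_id_weights hx, ← lc_id_weights hx'] at hff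
  rw [hK.linear _ hw hs, hK.linear _ hw' hs'] at hff
  rw [← lc_id_weights hx, ← lc_id_weights hx']
  exact hK.lc_id_eq_of_straightenWeight_eq hfib hw hw' hs hs' (hK.push _ _ hw hw' hs hs' hff) ht heq

end IsOrderedLift

end Homotopy

section Continuity

variable {X E W α : Type*} [NormedAddCommGroup W] [NormedSpace ℝ W]

theorem continuousOn_smul_of_norm_le [TopologicalSpace X] {s : Set X} {φ : X → ℝ} {ψ : X → W}
    {B : ℝ} (hφ : ContinuousOn φ s) (hψ : ContinuousOn ψ (s ∩ {x | φ x ≠ 0}))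
    (hB : ∀ x ∈ s, φ x ≠ 0 → ‖ψ x‖ ≤ B) : ContinuousOn (fun x => φ x • ψ x) s := by
  intro x hx
  by_cases h0 : φ x = 0
  · have hbound : ∀ y ∈ s, ‖φ y • ψ y‖ ≤ ‖φ y‖ * B := fun y hy => by
      by_cases hy0 : φ y = 0
      · simp [hy0]
      · rw [norm_smul]
        exact mul_le_mul_of_nonneg_left (hB y hy hy0) (norm_nonneg _)
    have hlim := ((hφ x hx).norm.mul_const B).tendsto
    rw [h0, norm_zero, zero_mul] at hlim
    rw [ContinuousWithinAt, h0, zero_smul]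
    exact squeeze_zero_norm' (eventually_nhdsWithin_of_forall hbound) hlim
  · exact (hφ x hx).smul ((hψ x ⟨hx, h0⟩).mono_of_mem_nhdsWithin
      (Filter.inter_mem self_mem_nhdsWithin ((hφ x hx).eventually_ne h0)))

variable [NormedAddCommGroup E] [NormedSpace ℝ E] {K : Finset (Finset E)} {g : E → W}

theorem IsComplex.space_eq_iUnion (hK : IsComplex K) :
    space K = ⋃ s : K, convexHull ℝ ((s : Finset E) : Set E) := by
  ext x
  simp [hK.mem_space_iff]

theorem IsComplex.isCompact_space (hK : IsComplex K) : IsCompact (space K) := by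
  rw [hK.space_eq_iUnion]
  exact isCompact_iUnion fun s => s.1.finite_toSet.isCompact_convexHull (𝕜 := ℝ)

variable [FiniteDimensional ℝ E]

theorem AffineOnFaces.continuousOn (hg : AffineOnFaces K g) (hK : IsComplex K) :
    ContinuousOn g (space K) := by
  rw [hK.space_eq_iUnion]
  refine (locallyFinite_of_finite _).continuousOn_iUnion (fun s => ?_) fun s => ?_
  · exact (s.1.finite_toSet.isCompact_convexHull (𝕜 := ℝ)).isClosed
  · obtain ⟨A, hA⟩ := hg s s.2
    exact (AffineMap.continuous_of_finiteDimensional A).continuousOn.congr hA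

namespace IsComplex

theorem continuousOn_lc_weights (hK : IsComplex K) (h : E → W) :
    ContinuousOn (fun x => lc h (weights K x)) (space K) :=
  have hlin := hK.linearOn_lc_weights h
  AffineOnFaces.continuousOn (fun _ hs => hlin.exists_affineMap hK hs) hK

theorem continuousOn_weights (hK : IsComplex K) (v : E) :
    ContinuousOn (fun x => weights K x v) (space K) := by
  refine (hK.continuousOn_lc_weights (Pi.single v (1 : ℝ))).congr fun x _ => ?_
  change weights K x v = lc (Pi.single v 1) (weights K x)
  rw [lc_eq_sum (Finset.subset_insert v _), Finset.sum_eq_single_of_mem v (by simp) (by simp_all)]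
  simp

variable [LinearOrder α] {κ : E → α}

theorem continuousOn_extract (hK : IsComplex K) (κ : E → α) (u : E) :
    ContinuousOn (fun p : ℝ × E => extract κ p.1 (weights K p.2) u) (univ ×ˢ space K) := by
  have hsnd : MapsTo Prod.snd ((univ : Set ℝ) ×ˢ space K) (space K) := fun _ hp => hp.2
  have hweight := (hK.continuousOn_weights u).comp continuousOn_snd hsnd
  have hbelow : ContinuousOn (fun p : ℝ × E => massBelow κ (weights K p.2) (κ u))
      (univ ×ˢ space K) := (hK.continuousOn_lc_weights _).comp continuousOn_snd hsnd
  simp only [extract_apply]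
  exact (continuousOn_fst.inf (hbelow.add hweight)).sub (continuousOn_fst.inf hbelow)

theorem continuousOn_lc_extract (hK : IsComplex K) (κ : E → α) (h : E → W) :
    ContinuousOn (fun p : ℝ × E => lc h (extract κ p.1 (weights K p.2))) (univ ×ˢ space K) := by
  have hsum : ContinuousOn
      (fun p : ℝ × E => ∑ u ∈ K.biUnion id, extract κ p.1 (weights K p.2) u • h u)
      (univ ×ˢ space K) :=
    continuousOn_finsetSum _ fun u _ => (hK.continuousOn_extract κ u).smul continuousOn_const
  refine hsum.congr fun p hp => lc_eq_sum ((support_extract _ _ _).trans fun u hu => ?_) h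
  exact Finset.mem_biUnion.2 ⟨_, support_weights_mem hp.2, hu⟩

theorem continuousOn_lc_remainder (hK : IsComplex K) (κ : E → α) (h : E → W) :
    ContinuousOn (fun p : ℝ × E => lc h (remainder κ p.1 (weights K p.2)))
      (univ ×ˢ space K ∩ {p | 1 - p.1 ≠ 0}) := by
  simp only [remainder, map_smul, map_sub]
  have hscale : ContinuousOn (fun p : ℝ × E => 1 - p.1) (univ ×ˢ space K ∩ {p | 1 - p.1 ≠ 0}) := by
    fun_prop
  refine (hscale.inv₀ fun p hp => hp.2).smul (ContinuousOn.mono ?_ inter_subset_left)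
  exact ((hK.continuousOn_lc_weights h).comp continuousOn_snd fun _ hp => hp.2).sub
    (hK.continuousOn_lc_extract κ h)

theorem continuousOn_straighten (hK : IsComplex K) (hκ : ∀ s ∈ K, InjOn κ (s : Set E))
    (hg : ContinuousOn g (space K)) :
    ContinuousOn (fun p : ℝ × E => straighten K κ g p.1 p.2) (Icc 0 1 ×ˢ space K) := by
  have hsub : Icc (0 : ℝ) 1 ×ˢ space K ⊆ univ ×ˢ space K := prod_mono_left (subset_univ _)
  have hmem : MapsTo (fun p : ℝ × E => lc id (remainder κ p.1 (weights K p.2)))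
      (Icc 0 1 ×ˢ space K ∩ {p | 1 - p.1 ≠ 0}) (space K) := by
    rintro p ⟨⟨⟨ht0, ht1⟩, hx⟩, hne⟩
    have hs := support_weights_mem hx
    exact ⟨_, (isWeight_weights hx).remainder ⟨ht0, ht1.lt_of_ne (sub_ne_zero.1 hne).symm⟩
      (hκ _ hs), hK.down _ hs _ (support_remainder κ _ _), rfl⟩
  obtain ⟨B, hB⟩ := (hK.isCompact_space.image_of_continuousOn hg).isBounded.exists_norm_le
  refine ((hK.continuousOn_lc_extract κ g).mono hsub).add
    (continuousOn_smul_of_norm_le (B := B) (by fun_prop)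
      (hg.comp ((hK.continuousOn_lc_remainder κ id).mono (inter_subset_inter_left _ hsub)) hmem)
      fun p hp hne => hB _ (mem_image_of_mem g (hmem ⟨hp, hne⟩)))

end IsComplex

end Continuity

section Straightening

variable {E F W α : Type*} [AddCommGroup E] [Module ℝ E] [AddCommGroup F] [Module ℝ F]
  [AddCommGroup W] [Module ℝ W] {K S : Finset (Finset E)} {g : E → W} {x : E}

theorem LinearOn.prodMk {f : E → F} (hf : LinearOn S f) (hg : LinearOn S g) :
    LinearOn S fun x => (f x, g x) := by
  intro w hw hs
  refine Prod.ext ((hf w hw hs).trans ?_) ((hg w hw hs).trans ?_)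
  · exact (Finsupp.apply_linearCombination ℝ (LinearMap.fst ℝ F W) (fun x => (f x, g x)) w).symm
  · exact (Finsupp.apply_linearCombination ℝ (LinearMap.snd ℝ F W) (fun x => (f x, g x)) w).symm

theorem AffineOnFaces.exists_affineMap_support_weights
    {Λ : Finset E → Finset (E →ᵃ[ℝ] ℝ)} (hg : AffineOnFaces S g)
    (hS : IsComplex S) (h : IsCutOut S (fun s => convexHull ℝ (s : Set E)) Λ) (hK : IsCut S Λ K)
    (hxK : x ∈ space K) (hxS : x ∈ space S) :
    ∃ A : E →ᵃ[ℝ] W, EqOn g A (convexHull ℝ ((weights K x).support : Set E)) := by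
  obtain ⟨s, hs, hxs⟩ := hS.mem_space_iff.1 hxS
  obtain ⟨A, hA⟩ := hg s hs
  rw [← lc_id_weights hxK] at hxs
  have hvert := (hK.mem_iff h hs (isWeight_weights hxK) (support_weights_mem hxK) subset_rfl).1 hxs
  exact ⟨A, hA.mono (convexHull_min hvert (convex_convexHull ℝ _))⟩

end Straightening

section ExistsStraightening

variable {E F W : Type*} [NormedAddCommGroup E] [NormedSpace ℝ E]
  [NormedAddCommGroup W] [NormedSpace ℝ W]

/-- A homotopy `H` of `g` fixing `C`, through maps which are injective on the fibres of `f`, to a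
map which is linear on the faces of `K`. -/
structure IsStraightening (K : Finset (Finset E)) (f : E → F) (g : E → W) (C : Set E)
    (H : ℝ → E → W) : Prop where
  continuousOn : ContinuousOn (fun p : ℝ × E => H p.1 p.2) (Icc 0 1 ×ˢ space K)
  zero : EqOn (H 0) g (space K)
  linear_one : LinearOn K (H 1)
  injective : ∀ t ∈ Icc (0 : ℝ) 1, ∀ x ∈ space K, ∀ y ∈ space K, f x = f y → H t x = H t y → x = y
  fixed : ∀ t ∈ Icc (0 : ℝ) 1, EqOn (H t) g (space K ∩ C)

variable [FiniteDimensional ℝ E] [NormedAddCommGroup F] [NormedSpace ℝ F]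

theorem IsOrderedLift.isStraightening {α : Type*} [LinearOrder α] {K : Finset (Finset E)}
    {f : E → F} {g : E → W} {o : F → α} (hK : IsOrderedLift K f g o)
    (hg : ContinuousOn g (space K))
    (hfib : ∀ x ∈ space K, ∀ y ∈ space K, f x = f y → g x = g y → x = y) {C : Set E}
    (hC : ∀ x ∈ space K, x ∈ C →
      ∃ A : E →ᵃ[ℝ] W, EqOn g A (convexHull ℝ ((weights K x).support : Set E))) :
    IsStraightening K f g C (straighten K (fun v => o (f v)) g) where
  continuousOn := hK.complex.continuousOn_straighten hK.ordInj hg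
  zero _ hx := straighten_zero _ g hx
  linear_one := hK.complex.linearOn_straighten_one _ g
  injective _ ht _ hx _ hy hf hH := hK.straighten_injective hfib ht hx hy hf hH
  fixed _ ht x hx := by
    obtain ⟨A, hA⟩ := hC x hx.1 hx.2
    exact hK.straighten_of_affine hx.1 ht hA

variable [FiniteDimensional ℝ F]

open scoped Pointwise in
theorem exists_affineIndependent_subset_convexHull {B : Set F} (hB : Bornology.IsBounded B) :
    ∃ s : Finset F, AffineIndependent ℝ ((↑) : s → F) ∧ B ⊆ convexHull ℝ (s : Set F) := by
  obtain ⟨b, hb, -⟩ := exists_mem_interior_convexHull_affineBasis (s := univ) (x := (0 : F))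
    Filter.univ_mem
  obtain ⟨r, hr, habs⟩ := ((NormedSpace.isVonNBounded_iff ℝ).2 hB
    (mem_interior_iff_mem_nhds.1 hb)).exists_pos
  have hrange : range (Units.mk0 r hr.ne' • b) = r • range b := (smul_set_range r b).symm
  refine ⟨(finite_range (Units.mk0 r hr.ne' • b)).toFinset,
    (Units.mk0 r hr.ne' • b).ind.range.mono (Finite.coe_toFinset _).subset, ?_⟩
  rw [Finite.coe_toFinset, hrange, convexHull_smul]
  exact habs r (le_abs_self r)

theorem exists_isStraightening {K S : Finset (Finset E)} {f : E → F} {g : E → W}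
    (hK : IsComplex K) (hf : AffineOnFaces K f)
    (hinj : ∀ δ ∈ K, InjOn f (convexHull ℝ (δ : Set E))) (hg : ContinuousOn g (space K))
    (hfib : ∀ x ∈ space K, ∀ y ∈ space K, f x = f y → g x = g y → x = y)
    (hS : IsComplex S) (hgS : AffineOnFaces S g) :
    ∃ (K' : Finset (Finset E)) (H : ℝ → E → W), IsComplex K' ∧ space K' = space K ∧
      LinearOn K' f ∧ IsStraightening K' f g (space S) H := by
  have hhalf : ∀ s ∈ S, ∃ Λ : Finset (E →ᵃ[ℝ] ℝ),
      convexHull ℝ (s : Set E) = {x | ∀ ℓ ∈ Λ, ℓ x ≤ 0} := fun s hs =>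
    exists_convexHull_eq_halfspaces (hS.affineIndependent hs)
  choose! Λ hΛ using hhalf
  obtain ⟨K₁, hK₁, hr, hcut⟩ := exists_isCut Λ S hK
  have hf₁ : AffineOnFaces K₁ f := fun s hs => by
    obtain ⟨t, ht, hst⟩ := hr.exists_convexHull_subset hs
    obtain ⟨A, hA⟩ := hf t ht
    exact ⟨A, hA.mono hst⟩
  have hinj₁ : ∀ δ ∈ K₁, InjOn f (convexHull ℝ (δ : Set E)) := fun δ hδ => by
    obtain ⟨t, ht, hst⟩ := hr.exists_convexHull_subset hδ
    exact (hinj t ht).mono hst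
  obtain ⟨s, hs, hsub⟩ := exists_affineIndependent_subset_convexHull
    (hK₁.isCompact_space.image_of_continuousOn (hf₁.continuousOn hK₁)).isBounded
  rw [← space_powerset, ← mapsTo_iff_image_subset] at hsub
  rw [← hr.space_eq] at hg hfib ⊢
  obtain ⟨K', o, hK', hsp, hsubK⟩ := exists_isOrderedLift hK₁ (isComplex_powerset hs) hf₁ hinj₁
    hsub hg hfib
  have hcut' : IsCut S Λ K' := fun i hi ℓ hℓ u hu => by
    obtain ⟨δ, hδ, huδ⟩ := hsubK u hu
    exact (hcut i hi ℓ hℓ δ hδ).mono (convexHull_min huδ (convex_convexHull ℝ _))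
  rw [← hsp] at hg hfib
  exact ⟨K', _, hK'.complex, hsp, hK'.linear, hK'.isStraightening hg hfib fun x hxK hxS =>
    hgS.exists_affineMap_support_weights hS hΛ hcut' hxK hxS⟩

end ExistsStraightening

section PLMaps

variable {E V W : Type*} [NormedAddCommGroup E] [NormedSpace ℝ E]
  [NormedAddCommGroup V] [NormedSpace ℝ V] [NormedAddCommGroup W] [NormedSpace ℝ W]
  {P : Set E} {h : P → V} {h' : E → V} {S : Finset (Finset E)}

theorem isPL_empty (h : (∅ : Set E) → V) : IsPL h :=
  ⟨⊥, ⟨finite_empty, Geometry.SimplicialComplex.space_bot⟩, fun s hs => absurd hs (notMem_empty s)⟩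

theorem isPL_right_of_prodMk {k : P → W} (hhk : IsPL fun x => (h x, k x)) : IsPL k := by
  obtain ⟨K, hK, hA⟩ := hhk
  refine ⟨K, hK, fun s hs => ?_⟩
  obtain ⟨A, hA⟩ := hA s hs
  exact ⟨(LinearMap.snd ℝ V W).toAffineMap.comp A, fun x hx => congrArg Prod.snd (hA x hx)⟩

theorem compactSpace_of_isPL (hh : IsPL h) : CompactSpace P := by
  obtain ⟨K, ⟨hfin, rfl⟩, -⟩ := hh
  obtain ⟨S, hS, -, hsp⟩ := exists_isComplex K hfin
  exact isCompact_iff_compactSpace.1 (hsp ▸ hS.isCompact_space)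

theorem exists_affineOnFaces_of_isPL (hh : IsPL h) (heq : ∀ x : P, h' x = h x) :
    ∃ S, IsComplex S ∧ space S = P ∧ AffineOnFaces S h' := by
  obtain ⟨K, ⟨hfin, rfl⟩, hA⟩ := hh
  obtain ⟨S, hS, hmem, hsp⟩ := exists_isComplex K hfin
  refine ⟨S, hS, hsp, fun s hs => ?_⟩
  rcases (hmem s).1 hs with rfl | hsK
  · exact ⟨0, by simp⟩
  · obtain ⟨A, hA⟩ := hA s hsK
    exact ⟨A, fun x hx => (heq ⟨x, K.convexHull_subset_space hsK hx⟩).trans (hA _ hx)⟩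

theorem continuous_of_isPL [FiniteDimensional ℝ E] (hh : IsPL h) : Continuous h := by
  have hext (x : P) : Function.extend Subtype.val h 0 x = h x :=
    Subtype.val_injective.extend_apply h 0 x
  obtain ⟨S, hS, rfl, hA⟩ := exists_affineOnFaces_of_isPL hh hext
  exact (hA.continuousOn hS).domRestrict.congr hext

theorem isPL_of_linearOn (hS : IsComplex S) (hsp : space S = P) (hlin : LinearOn S h')
    (heq : ∀ x : P, h' x = h x) : IsPL h := by
  subst hsp
  refine ⟨_, hS.isTriangulation, fun s hs => ?_⟩
  obtain ⟨A, hA⟩ := hlin.exists_affineMap hS hs.1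
  exact ⟨A, fun x hx => (heq x).symm.trans (hA hx)⟩

theorem isPLEmbedding_of_linearOn (hS : IsComplex S) (hsp : space S = P) (hlin : LinearOn S h')
    (heq : ∀ x : P, h' x = h x) (hinj : Function.Injective h) : IsPLEmbedding h := by
  have hinjOn : InjOn h' (space S) := by
    rw [hsp, injOn_iff_injective]
    exact fun x y hxy => hinj ((heq x).symm.trans (hxy.trans (heq y)))
  have hrange : space (S.image (Finset.image h')) = range h := by
    rw [hlin.space_image hS, hsp, image_eq_range]
    exact congrArg range (funext heq)
  have hleft := hinjOn.leftInvOn_invFunOn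
  refine ⟨isPL_of_linearOn hS hsp hlin heq, (Equiv.ofInjective h hinj).symm,
    isPL_of_linearOn (hlin.isComplex_image hS hinjOn) hrange (hlin.of_leftInvOn hS hleft) ?_,
    (Equiv.ofInjective h hinj).symm_apply_apply⟩
  rintro ⟨_, x, rfl⟩
  rw [Equiv.ofInjective_symm_apply]
  exact (congrArg _ (heq x).symm).trans (hleft (hsp ▸ x.2))

end PLMaps

section Lifts

variable {E F W : Type*} [NormedAddCommGroup E] [NormedSpace ℝ E]
  [NormedAddCommGroup F] [NormedSpace ℝ F] [NormedAddCommGroup W] [NormedSpace ℝ W]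
  {N N₀ : Set E} {M : Set F} {f : N → M} {f' : E → F} {g : N → W} {g' : E → W}
  {K : Finset (Finset E)}

theorem AffineOnFaces.injOn_of_isNondegenerate (hf : AffineOnFaces K f') (hK : IsComplex K)
    (hsp : space K = N) (hnd : IsNondegenerate f) (hfe : ∀ x : N, f' x = f x) {s : Finset E}
    (hs : s ∈ K) : InjOn f' (convexHull ℝ (s : Set E)) := by
  obtain ⟨A, hA⟩ := hf s hs
  have hsN : convexHull ℝ (s : Set E) ⊆ N := fun x hx => hsp ▸ hK.mem_space_iff.2 ⟨s, hs, hx⟩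
  intro x hx y hy hxy
  by_contra hne
  have hsegment : segment ℝ x y ⊆ (fun z : N => (z : E)) '' (f ⁻¹' {f ⟨x, hsN hx⟩}) := by
    intro z hz
    have hzs := (convex_convexHull ℝ _).segment_subset hx hy hz
    have hAz : A z ∈ A '' segment ℝ x y := mem_image_of_mem A hz
    rw [image_segment, ← hA hy, ← hxy, hA hx, segment_same, mem_singleton_iff] at hAz
    refine ⟨⟨z, hsN hzs⟩, Subtype.ext ?_, rfl⟩
    rw [← hfe, ← hfe, hA hzs, hA hx, hAz]
  refine hnd (f ⟨x, hsN hx⟩) (zero_lt_one.trans_le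
    (le_sSup ⟨1, ⟨![x, y], affineIndependent_of_ne ℝ hne, ?_⟩, rfl⟩))
  rwa [Matrix.range_cons_cons_empty, convexHull_pair]

variable [FiniteDimensional ℝ E]

theorem isEmbedding_of_isPLEmbedding (h : IsPLEmbedding fun x => ((f x : F), g x)) :
    Topology.IsEmbedding fun x => (f x, g x) := by
  obtain ⟨hPL, r, -, hr⟩ := h
  have := compactSpace_of_isPL hPL
  have hcont := continuous_of_isPL hPL
  have hfc : Continuous f := Topology.IsInducing.subtypeVal.continuous_iff.2 hcont.fst
  have hinj : Function.Injective fun x => (f x, g x) := by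
    intro x y hxy
    rw [Prod.mk.injEq] at hxy
    exact hr.injective (Subtype.ext (Prod.ext (congrArg Subtype.val hxy.1) hxy.2))
  exact ((hfc.prodMk hcont.snd).isClosedEmbedding hinj).isEmbedding

variable [FiniteDimensional ℝ F]

theorem exists_isStraightening_of_isPL (hf : IsPL fun x => (f x : F)) (hnd : IsNondegenerate f)
    (hg : Continuous g) (hinj : Function.Injective fun x => (f x, g x)) (hsub : N₀ ⊆ N)
    (hPL : IsPL fun x : N₀ => g (inclusion hsub x)) (hfe : ∀ x : N, f' x = f x)
    (hge : ∀ x : N, g' x = g x) :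
    ∃ (K : Finset (Finset E)) (H : ℝ → E → W), IsComplex K ∧ space K = N ∧ LinearOn K f' ∧
      IsStraightening K f' g' N₀ H := by
  obtain ⟨K, hK, hsp, hfA⟩ := exists_affineOnFaces_of_isPL hf hfe
  obtain ⟨S, hS, rfl, hgA⟩ := exists_affineOnFaces_of_isPL hPL fun x => hge (inclusion hsub x)
  have hgc : ContinuousOn g' N := continuousOn_iff_continuous_domRestrict.2
    (hg.congr fun x => (hge x).symm)
  have hfib : ∀ x ∈ N, ∀ y ∈ N, f' x = f' y → g' x = g' y → x = y := by
    intro x hx y hy hfxy hgxy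
    lift x to N using hx
    lift y to N using hy
    rw [hfe, hfe] at hfxy
    rw [hge, hge] at hgxy
    exact congrArg _ (hinj (Prod.ext (Subtype.ext hfxy) hgxy))
  rw [← hsp] at hgc hfib ⊢
  exact exists_isStraightening hK hfA (fun δ hδ => hfA.injOn_of_isNondegenerate hK hsp hnd hfe hδ)
    hgc hfib hS hgA

theorem exists_homotopy_isPLEmbedding (hf : IsPL fun x => (f x : F)) (hnd : IsNondegenerate f)
    (hg : Continuous g) (hinj : Function.Injective fun x => (f x, g x)) (hsub : N₀ ⊆ N)
    (hPL : IsPL fun x : N₀ => g (inclusion hsub x)) :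
    ∃ H : unitInterval × N → W, Continuous H ∧ (∀ x, H (0, x) = g x) ∧
      IsPLEmbedding (fun x => ((f x : F), H (1, x))) ∧
      (∀ t, Function.Injective fun x => (f x, H (t, x))) ∧
      ∀ t, ∀ x : N, (x : E) ∈ N₀ → H (t, x) = g x := by
  have hfe := Subtype.val_injective.extend_apply (fun x => (f x : F)) 0
  have hge := Subtype.val_injective.extend_apply g 0
  obtain ⟨K, H, hK, hsp, hlin, hH⟩ :=
    exists_isStraightening_of_isPL hf hnd hg hinj hsub hPL hfe hge
  have hmem (x : N) : (x : E) ∈ space K := hsp ▸ x.2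
  have hHinj (t : unitInterval) : Function.Injective fun x : N => (f x, H t x) := by
    intro x y hxy
    rw [Prod.mk.injEq] at hxy
    refine Subtype.ext (hH.injective t t.2 x (hmem x) y (hmem y) ?_ hxy.2)
    rw [hfe, hfe, hxy.1]
  refine ⟨fun p => H p.1 p.2, ?_, fun x => (hH.zero (hmem x)).trans (hge x), ?_, hHinj,
    fun t x hx => (hH.fixed t t.2 ⟨hmem x, hx⟩).trans (hge x)⟩
  · exact hH.continuousOn.comp_continuous (f := fun p : unitInterval × N => ((p.1 : ℝ), (p.2 : E)))
      (by fun_prop) fun p => ⟨p.1.2, hmem p.2⟩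
  · refine isPLEmbedding_of_linearOn hK hsp (hlin.prodMk hH.linear_one)
      (fun x => Prod.ext (hfe x) rfl) fun x y hxy => hHinj 1 ?_
    rw [Prod.mk.injEq] at hxy
    exact Prod.ext (Subtype.ext hxy.1) hxy.2

end Lifts

section IsotopyOfLifts

variable {E F W : Type*} [NormedAddCommGroup E] [NormedSpace ℝ E] [FiniteDimensional ℝ E]
  [NormedAddCommGroup F] [NormedSpace ℝ F] [FiniteDimensional ℝ F]
  [NormedAddCommGroup W] [NormedSpace ℝ W] {N N₀ : Set E} {M : Set F} {f : N → M}

theorem exists_isotopy_isPLEmbedding {e : N → M × W} (hf : IsPL fun x => (f x : F))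
    (hnd : IsNondegenerate f) (he : Topology.IsEmbedding e) (hlift : ∀ x, (e x).1 = f x)
    (hsub : N₀ ⊆ N) (hPL : IsPL fun x : N₀ => (e (inclusion hsub x)).2) :
    ∃ e' : N → M × W, IsPLEmbedding (fun x => (((e' x).1 : F), (e' x).2)) ∧
      ∃ H : unitInterval × N → M × W, Continuous H ∧ (∀ x, H (0, x) = e x) ∧
        (∀ x, H (1, x) = e' x) ∧
        (∀ t, Topology.IsEmbedding (fun x => H (t, x)) ∧ ∀ x, (H (t, x)).1 = f x) ∧
        ∀ t, ∀ x : N, (x : E) ∈ N₀ → H (t, x) = e x := by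
  have hfc : Continuous f := he.continuous.fst.congr hlift
  have := compactSpace_of_isPL hf
  obtain ⟨H, hH, hH0, hH1, hHinj, hfix⟩ := exists_homotopy_isPLEmbedding hf hnd he.continuous.snd
    (by simpa only [← hlift] using he.injective) hsub hPL
  have hlevel (t : unitInterval) : Continuous fun x => (f x, H (t, x)) := by fun_prop
  exact ⟨_, hH1, fun p => (f p.2, H p), by fun_prop,
    fun x => Prod.ext (hlift x).symm (hH0 x), fun _ => rfl,
    fun t => ⟨((hlevel t).isClosedEmbedding (hHinj t)).isEmbedding, fun _ => rfl⟩,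
    fun t x hx => Prod.ext (hlift x).symm (hfix t x hx)⟩

end IsotopyOfLifts

end PLLift

open Set in
theorem mainTheorem1_general {E F W : Type*}
    [NormedAddCommGroup E] [NormedSpace ℝ E] [FiniteDimensional ℝ E]
    [NormedAddCommGroup F] [NormedSpace ℝ F] [FiniteDimensional ℝ F]
    [NormedAddCommGroup W] [NormedSpace ℝ W] {N : Set E} {M : Set F}
    (f : N → M) (hf : IsPL fun x => (f x : F)) (hnd : IsNondegenerate f) :
    ((∃ g : N → W, Topology.IsEmbedding fun x => (f x, g x)) ↔
      ∃ g : N → W, IsPLEmbedding fun x => ((f x : F), g x)) ∧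
    ∀ e : N → M × W, Topology.IsEmbedding e → (∀ x, (e x).1 = f x) →
      ∀ (N₀ : Set E) (hsub : N₀ ⊆ N),
        IsPL (fun x : N₀ => (((e (inclusion hsub x)).1 : F), (e (inclusion hsub x)).2)) →
        ∃ e' : N → M × W, IsPLEmbedding (fun x => (((e' x).1 : F), (e' x).2)) ∧
          ∃ H : unitInterval × N → M × W, Continuous H ∧ (∀ x, H (0, x) = e x) ∧
            (∀ x, H (1, x) = e' x) ∧
            (∀ t, Topology.IsEmbedding (fun x => H (t, x)) ∧ ∀ x, (H (t, x)).1 = f x) ∧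
            ∀ t, ∀ x : N, (x : E) ∈ N₀ → H (t, x) = e x := by
  refine ⟨⟨fun ⟨g, hg⟩ => ?_, fun ⟨g, hg⟩ => ⟨g, PLLift.isEmbedding_of_isPLEmbedding hg⟩⟩,
    fun e he hlift N₀ hsub hPL =>
      PLLift.exists_isotopy_isPLEmbedding hf hnd he hlift hsub (PLLift.isPL_right_of_prodMk hPL)⟩
  obtain ⟨H, -, -, hPL, -⟩ := PLLift.exists_homotopy_isPLEmbedding hf hnd hg.continuous.snd
    hg.injective (empty_subset N) (PLLift.isPL_empty _)
  exact ⟨_, hPL⟩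

theorem mainTheorem1 {E F : Type*}
    [NormedAddCommGroup E] [NormedSpace ℝ E] [FiniteDimensional ℝ E]
    [NormedAddCommGroup F] [NormedSpace ℝ F] [FiniteDimensional ℝ F]
    {N : Set E} {M : Set F}
    (hN : IsCompactPolyhedron N) (hM : IsCompactPolyhedron M)
    (f : N → M) (hf : IsPL (fun x => (f x : F))) (hnd : IsNondegenerate f) (k : ℕ) :
    (IsTopologicalPrem k f ↔ IsPLPrem k f) ∧
    (∀ e : N → M × EuclideanSpace ℝ (Fin k), Topology.IsEmbedding e → IsLift f e →
      (∃ e' : N → M × EuclideanSpace ℝ (Fin k),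
        IsPLEmbedding (fun x => prodIncl (e' x)) ∧ IsotopicThroughLiftsRel f ∅ e e') ∧
      ∀ (N₀ : Set E) (_ : IsCompactPolyhedron N₀) (hsub : N₀ ⊆ N),
        IsPL (fun x : N₀ => prodIncl (e (Set.inclusion hsub x))) →
        ∃ e' : N → M × EuclideanSpace ℝ (Fin k),
          IsPLEmbedding (fun x => prodIncl (e' x)) ∧ IsotopicThroughLiftsRel f N₀ e e') := by
  obtain ⟨hiff, hiso⟩ := mainTheorem1_general (W := EuclideanSpace ℝ (Fin k)) f hf hnd
  exact ⟨hiff, fun e he hlift => ⟨hiso e he hlift ∅ (Set.empty_subset N) (PLLift.isPL_empty _),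
    fun N₀ _ hsub => hiso e he hlift N₀ hsub⟩⟩
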